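/- Let $\mathcal V$ be either the category $\mathsf{Set}$ of sets with its cartesian product, or the category $\mathsf M_k$ of modules over a commutative ring $k$ with $\otimes_k$ (in particular, for $k=\mathbb Z$, the category $\mathsf{Ab}$ of abelian groups). For $\mathcal V=\mathsf{Set}$ a $\mathcal V$-category is an ordinary category, and $\mathcal V$-functors and $\mathcal V$-monoidal structures are ordinary functors and monoidal structures; for $\mathcal V=\mathsf M_k$ categories and functors are $k$-linear, and monoidal products are $k$-bilinear on morphisms. **Essentially strong monoidal functors.** Let $(\mathcal C,\boxtimes,e)$ be a $\mathcal V$-monoidal $\mathcal V$-category and $(G,G_2,G_0)\colon\mathcal C\to\mathcal V$ a (lax) monoidal $\mathcal V$-functor. Then $R:=Ge$ is a monoid in $\mathcal V$ with unit $G_0$ and multiplication $G(\mathbf l_e)\circ G_{e,e}$, each $Gc$ is an $R$-$R$-bimodule $Uc$ with actions $G(\mathbf l_c)\circ G_{e,c}$ and $G(\mathbf r_c)\circ G_{c,e}$, and $G_{a,b}$ induces a bimodule morphism $U_{a,b}\colon Ua\otimes_R Ub\to U(a\boxtimes b)$; together with $U_0=\mathrm{id}\colon R\to Ue$ this is a monoidal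 functor $U\colon\mathcal C\to{}_R\mathcal V_R$ through which $G$ factorizes. $G$ is *essentially strong monoidal* if $U$ is strong monoidal. **Bialgebroids.** A (right) *bialgebroid* in $\mathcal V$ consists of monoids $R$ and $A$ in $\mathcal V$, monoid morphisms $s\colon R\to A$ and $t\colon R^{\rm op}\to A$ with $s(r)t(r')=t(r')s(r)$, and a comonoid structure $\delta\colon A\to A\otimes_R A$, $\delta(a)=a_1\otimes a_2$, $\varepsilon\colon A\to R$ in ${}_R\mathcal V_R$ on the bimodule $A$ with $r\cdot a\cdot r'=a\,t(r)s(r')$, such that $s(r)a_1\otimes a_2=a_1\otimes t(r)a_2$, $\delta(1)=1\otimes 1$, $\delta(ab)=a_1b_1\otimes a_2b_2$, $\varepsilon(1)=1$ and $\varepsilon(s(\varepsilon(a))b)=\varepsilon(ab)=\varepsilon(t(\varepsilon(a))b)$. The category $\mathcal V_A$ of right $A$-modules is then monoidal: the product of $X$ and $Y$ is $X\otimes_R Y$ with the action $(x\otimes y)a=xa_1\otimes ya_2$, and the unit is $R$ with the action $r\cdot a=\varepsilon(s(r)a)$. The *long forgetful functor* of $A$ is the composite $G^A\colon\mathcal V_A\to{}_R\mathcal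 V_R\to\mathcal V$ of the forgetful functors, with its canonical (lax) monoidal structure. **Categories over $\mathcal V$.** $\mathcal V\text{-}\mathsf{Cat}/\mathcal V$ is the 2-category whose objects are the $\mathcal V$-functors to $\mathcal V$, whose arrows $F\to G$ are the $\mathcal V$-functors $K$ together with an isomorphism $F\cong GK$, and whose 2-cells are the natural transformations compatible with these isomorphisms. $\mathcal V\text{-}\mathsf{MonCat}/\mathcal V$ is defined similarly, with $\mathcal V$-monoidal categories, monoidal $\mathcal V$-functors and monoidal natural transformations. **Theorem.** Let $\mathcal C$ be a $\mathcal V$-category and $G\colon\mathcal C\to\mathcal V$ a $\mathcal V$-functor. 1. $G$ is equivalent in $\mathcal V\text{-}\mathsf{Cat}/\mathcal V$ to the long forgetful functor $G^A$ of some bialgebroid $A$ in $\mathcal V$ if and only if * $G$ is monadic, * $G$ has a right adjoint, and * there are a $\mathcal V$-monoidal structure on $\mathcal C$ and, with respect to it, an essentially strong monoidal structure $(G,G_2,G_0)$ on $G$. 2. If $G$ is monadic and has a right adjoint, then for every $\mathcal V$-monoidal structure on $\mathcal C$ and every essentially strong monoidal structure on $G$ there is a bialgebroid $A$ in $\mathcal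 V$ such that $G$ and $G^A$ are equivalent in $\mathcal V\text{-}\mathsf{MonCat}/\mathcal V$; the equivalence can be chosen to consist of strong monoidal functors. -/

import Mathlib

open CategoryTheory CategoryTheory.Limits CategoryTheory.MonoidalCategory

set_option linter.unusedSectionVars false

universe w v u

namespace LongForgetful

section Elements
variable {V : Type u} [Category.{v} V] [MonoidalCategory V]

/-- The element `x ⊗ y` of `X ⊗ Y`, for elements `x : 𝟙_ V ⟶ X` and `y : 𝟙_ V ⟶ Y`. -/
def pair {X Y : V} (x : 𝟙_ V ⟶ X) (y : 𝟙_ V ⟶ Y) : 𝟙_ V ⟶ X ⊗ Y :=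
  (λ_ (𝟙_ V)).inv ≫ (x ⊗ₘ y)

lemma pair_whiskerRight {X Y X' : V} (x : 𝟙_ V ⟶ X) (y : 𝟙_ V ⟶ Y) (f : X ⟶ X') :
    pair x y ≫ f ▷ Y = pair (x ≫ f) y := by
  simp only [pair, Category.assoc, ← tensorHom_id, tensorHom_comp_tensorHom, Category.comp_id]

lemma pair_whiskerLeft {X Y Y' : V} (x : 𝟙_ V ⟶ X) (y : 𝟙_ V ⟶ Y) (f : Y ⟶ Y') :
    pair x y ≫ X ◁ f = pair x (y ≫ f) := by
  simp only [pair, Category.assoc, ← id_tensorHom, tensorHom_comp_tensorHom, Category.comp_id]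

lemma pair_tensorHom {X Y X' Y' : V} (x : 𝟙_ V ⟶ X) (y : 𝟙_ V ⟶ Y) (f : X ⟶ X') (g : Y ⟶ Y') :
    pair x y ≫ (f ⊗ₘ g) = pair (x ≫ f) (y ≫ g) := by
  simp [pair]

lemma pair_associator {X Y Z : V} (x : 𝟙_ V ⟶ X) (y : 𝟙_ V ⟶ Y) (z : 𝟙_ V ⟶ Z) :
    pair (pair x y) z ≫ (α_ X Y Z).hom = pair x (pair y z) := by
  have h : pair (pair x y) z = pair (λ_ (𝟙_ V)).inv (𝟙 _) ≫ ((x ⊗ₘ y) ⊗ₘ z) := by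
    rw [pair_tensorHom, Category.id_comp]; rfl
  have h' : pair x (pair y z) = pair (𝟙 _) (λ_ (𝟙_ V)).inv ≫ (x ⊗ₘ (y ⊗ₘ z)) := by
    rw [pair_tensorHom, Category.id_comp]; rfl
  rw [h, h', Category.assoc, associator_naturality]
  simp only [pair, tensorHom_id, id_tensorHom, Category.assoc]
  monoidal

lemma pair_associator_inv {X Y Z : V} (x : 𝟙_ V ⟶ X) (y : 𝟙_ V ⟶ Y) (z : 𝟙_ V ⟶ Z) :
    pair x (pair y z) ≫ (α_ X Y Z).inv = pair (pair x y) z := by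
  rw [← pair_associator, Category.assoc, Iso.hom_inv_id, Category.comp_id]

lemma comp_leftUnitor_inv {X : V} (x : 𝟙_ V ⟶ X) : x ≫ (λ_ X).inv = pair (𝟙 _) x := by
  rw [leftUnitor_inv_naturality, pair, id_tensorHom]

lemma comp_rightUnitor_inv {X : V} (x : 𝟙_ V ⟶ X) : x ≫ (ρ_ X).inv = pair x (𝟙 _) := by
  rw [rightUnitor_inv_naturality, pair, tensorHom_id, unitors_inv_equal]

lemma pair_braiding [BraidedCategory V] {X Y : V} (x : 𝟙_ V ⟶ X) (y : 𝟙_ V ⟶ Y) :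
    pair x y ≫ (β_ X Y).hom = pair y x := by
  have : (λ_ (𝟙_ V)).inv ≫ (β_ (𝟙_ V) (𝟙_ V)).hom = (λ_ (𝟙_ V)).inv := by
    rw [braiding_tensorUnit_left, unitors_equal, Iso.hom_inv_id, Category.comp_id]
  rw [pair, Category.assoc, BraidedCategory.braiding_naturality, reassoc_of% this, pair]

lemma pair_tensorμ [BraidedCategory V] {X Y Z W : V} (x : 𝟙_ V ⟶ X) (y : 𝟙_ V ⟶ Y)
    (z : 𝟙_ V ⟶ Z) (w : 𝟙_ V ⟶ W) :
    pair (pair x y) (pair z w) ≫ tensorμ X Y Z W = pair (pair x z) (pair y w) := by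
  simp only [tensorμ]
  rw [← Category.assoc, pair_associator, ← Category.assoc, pair_whiskerLeft,
    pair_associator_inv, ← Category.assoc, pair_whiskerLeft, pair_whiskerRight, pair_braiding,
    ← Category.assoc, pair_whiskerLeft, pair_associator, pair_associator_inv]

section Assoc
variable {W : V}

lemma pair_whiskerRight_assoc {X Y X' : V} (x : 𝟙_ V ⟶ X) (y : 𝟙_ V ⟶ Y) (f : X ⟶ X')
    (h : X' ⊗ Y ⟶ W) : pair x y ≫ f ▷ Y ≫ h = pair (x ≫ f) y ≫ h := by
  rw [← Category.assoc, pair_whiskerRight]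

lemma pair_whiskerLeft_assoc {X Y Y' : V} (x : 𝟙_ V ⟶ X) (y : 𝟙_ V ⟶ Y) (f : Y ⟶ Y')
    (h : X ⊗ Y' ⟶ W) : pair x y ≫ X ◁ f ≫ h = pair x (y ≫ f) ≫ h := by
  rw [← Category.assoc, pair_whiskerLeft]

lemma pair_tensorHom_assoc {X Y X' Y' : V} (x : 𝟙_ V ⟶ X) (y : 𝟙_ V ⟶ Y) (f : X ⟶ X')
    (g : Y ⟶ Y') (h : X' ⊗ Y' ⟶ W) :
    pair x y ≫ (f ⊗ₘ g) ≫ h = pair (x ≫ f) (y ≫ g) ≫ h := by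
  rw [← Category.assoc, pair_tensorHom]

lemma pair_associator_assoc {X Y Z : V} (x : 𝟙_ V ⟶ X) (y : 𝟙_ V ⟶ Y) (z : 𝟙_ V ⟶ Z)
    (h : X ⊗ Y ⊗ Z ⟶ W) :
    pair (pair x y) z ≫ (α_ X Y Z).hom ≫ h = pair x (pair y z) ≫ h := by
  rw [← Category.assoc, pair_associator]

lemma pair_associator_inv_assoc {X Y Z : V} (x : 𝟙_ V ⟶ X) (y : 𝟙_ V ⟶ Y) (z : 𝟙_ V ⟶ Z)
    (h : (X ⊗ Y) ⊗ Z ⟶ W) :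
    pair x (pair y z) ≫ (α_ X Y Z).inv ≫ h = pair (pair x y) z ≫ h := by
  rw [← Category.assoc, pair_associator_inv]

lemma pair_braiding_assoc [BraidedCategory V] {X Y : V} (x : 𝟙_ V ⟶ X) (y : 𝟙_ V ⟶ Y)
    (h : Y ⊗ X ⟶ W) : pair x y ≫ (β_ X Y).hom ≫ h = pair y x ≫ h := by
  rw [← Category.assoc, pair_braiding]

lemma pair_tensorμ_assoc [BraidedCategory V] {X Y Z U : V} (x : 𝟙_ V ⟶ X) (y : 𝟙_ V ⟶ Y)
    (z : 𝟙_ V ⟶ Z) (u : 𝟙_ V ⟶ U) (h : (X ⊗ Z) ⊗ (Y ⊗ U) ⟶ W) :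
    pair (pair x y) (pair z u) ≫ tensorμ X Y Z U ≫ h = pair (pair x z) (pair y u) ≫ h := by
  rw [← Category.assoc, pair_tensorμ]

end Assoc

section Mon
variable (A : Mon V)

lemma pair_mul_assoc (a b c : 𝟙_ V ⟶ A.X) :
    pair (pair a b ≫ MonObj.mul) c ≫ MonObj.mul = pair a (pair b c ≫ MonObj.mul) ≫ MonObj.mul := by
  have h := congr(pair (pair a b) c ≫ $(MonObj.mul_assoc A.X))
  simpa only [pair_whiskerRight_assoc, pair_associator_assoc, pair_whiskerLeft_assoc] using h

lemma pair_one_mul (a : 𝟙_ V ⟶ A.X) : pair MonObj.one a ≫ MonObj.mul = a := by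
  have h := congr(a ≫ (λ_ _).inv ≫ $(MonObj.one_mul A.X))
  rw [← Category.assoc, comp_leftUnitor_inv, pair_whiskerRight_assoc] at h
  simpa using h

lemma pair_mul_one (a : 𝟙_ V ⟶ A.X) : pair a MonObj.one ≫ MonObj.mul = a := by
  have h := congr(a ≫ (ρ_ _).inv ≫ $(MonObj.mul_one A.X))
  rw [← Category.assoc, comp_rightUnitor_inv, pair_whiskerLeft_assoc] at h
  simpa using h

end Mon

end Elements

/-- The monoidal unit is a generator. This holds in the category of sets and in the category of
modules over a commutative ring, and lets us check identities on elements `𝟙_ V ⟶ X`. -/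
class UnitGenerator (V : Type u) [Category.{v} V] [MonoidalCategory V] : Prop where
  isSeparator : IsSeparator (𝟙_ V)

instance : UnitGenerator (Type u) where
  isSeparator := by
    rw [isSeparator_def]
    intro X Y f g h
    ext x
    have := h (TypeCat.ofHom fun _ => x)
    have := congr($this PUnit.unit)
    simpa using this

instance (k : Type u) [CommRing k] : UnitGenerator (ModuleCat.{u} k) where
  isSeparator := by
    rw [isSeparator_def]
    intro X Y f g h
    ext x
    have := h (ModuleCat.ofHom (LinearMap.toSpanSingleton k X x))
    have := congr($this (1 : k))
    have e : (LinearMap.toSpanSingleton k X x) (1 : k) = x := by simp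
    simp at this
    exact e ▸ this

section Base
variable {V : Type u} [Category.{v} V] [MonoidalCategory V] [SymmetricCategory V] [MonoidalClosed V] [UnitGenerator V]

instance (X : V) : PreservesColimitsOfSize.{0,0} (tensorLeft X) := inferInstance

instance (X : V) : PreservesColimitsOfSize.{0,0} (tensorRight X) :=
  preservesColimits_of_natIso (BraidedCategory.tensorLeftIsoTensorRight X)

lemma ext_one {X Y : V} {f g : X ⟶ Y} (h : ∀ x : 𝟙_ V ⟶ X, x ≫ f = x ≫ g) : f = g :=
  UnitGenerator.isSeparator.def f g h

lemma ext_left {X Y Z : V} {f g : X ⊗ Y ⟶ Z}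
    (h : ∀ x : 𝟙_ V ⟶ X, x ▷ Y ≫ f = x ▷ Y ≫ g) : f = g := by
  rw [← cancel_epi (β_ Y X).hom]
  apply MonoidalClosed.curry_injective
  apply ext_one
  intro x
  rw [← MonoidalClosed.curry_natural_left, ← MonoidalClosed.curry_natural_left,
    BraidedCategory.braiding_naturality_right_assoc, h, BraidedCategory.braiding_naturality_right_assoc]

lemma ext_pair {X Y Z : V} {f g : X ⊗ Y ⟶ Z}
    (h : ∀ (x : 𝟙_ V ⟶ X) (y : 𝟙_ V ⟶ Y), pair x y ≫ f = pair x y ≫ g) : f = g := by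
  apply ext_left
  intro x
  rw [← cancel_epi (λ_ Y).inv]
  apply ext_one
  intro y
  have e : y ≫ (λ_ Y).inv ≫ x ▷ Y = pair x y := by
    rw [← Category.assoc, comp_leftUnitor_inv, pair_whiskerRight, Category.id_comp]
  have h' := h x y
  rw [← e] at h'
  simpa only [Category.assoc] using h'

lemma ext_pair₃ {X Y Z W : V} {f g : X ⊗ (Y ⊗ Z) ⟶ W}
    (h : ∀ (x : 𝟙_ V ⟶ X) (y : 𝟙_ V ⟶ Y) (z : 𝟙_ V ⟶ Z),
      pair x (pair y z) ≫ f = pair x (pair y z) ≫ g) : f = g := by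
  apply ext_left
  intro x
  rw [← cancel_epi (λ_ _).inv]
  apply ext_pair
  intro y z
  have e : pair y z ≫ (λ_ _).inv ≫ x ▷ _ = pair x (pair y z) := by
    rw [← Category.assoc, comp_leftUnitor_inv, pair_whiskerRight, Category.id_comp]
  have h' := h x y z
  rw [← e] at h'
  simpa only [Category.assoc] using h'

lemma ext_pair₃' {X Y Z W : V} {f g : (X ⊗ Y) ⊗ Z ⟶ W}
    (h : ∀ (x : 𝟙_ V ⟶ X) (y : 𝟙_ V ⟶ Y) (z : 𝟙_ V ⟶ Z),
      pair (pair x y) z ≫ f = pair (pair x y) z ≫ g) : f = g := by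
  rw [← cancel_epi (α_ _ _ _).inv]
  apply ext_pair₃
  intro x y z
  rw [pair_associator_inv_assoc, pair_associator_inv_assoc, h]

lemma pair_eq_comp {X Y W : V} (x : 𝟙_ V ⟶ X) (y : 𝟙_ V ⟶ Y) (f : X ⊗ Y ⟶ W) :
    pair x y ≫ f = y ≫ (λ_ Y).inv ≫ x ▷ Y ≫ f := by
  rw [← Category.assoc y, comp_leftUnitor_inv, pair_whiskerRight_assoc, Category.id_comp]

lemma ext_pair₅ {X Y A R B W : V} {f g : (X ⊗ Y) ⊗ ((A ⊗ R) ⊗ B) ⟶ W}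
    (h : ∀ (x : 𝟙_ V ⟶ X) (y : 𝟙_ V ⟶ Y) (a : 𝟙_ V ⟶ A) (r : 𝟙_ V ⟶ R) (b : 𝟙_ V ⟶ B),
      pair (pair x y) (pair (pair a r) b) ≫ f = pair (pair x y) (pair (pair a r) b) ≫ g) :
    f = g := by
  apply ext_pair₃'
  intro x y z
  rw [pair_eq_comp, pair_eq_comp]
  congr 1
  apply ext_pair₃'
  intro a r b
  rw [← pair_eq_comp, ← pair_eq_comp, h]

lemma ext_pair₄ {X Y Z U W : V} {f g : ((X ⊗ Y) ⊗ Z) ⊗ U ⟶ W}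
    (h : ∀ (x : 𝟙_ V ⟶ X) (y : 𝟙_ V ⟶ Y) (z : 𝟙_ V ⟶ Z) (u : 𝟙_ V ⟶ U),
      pair (pair (pair x y) z) u ≫ f = pair (pair (pair x y) z) u ≫ g) : f = g := by
  rw [← cancel_epi (β_ _ _).hom]
  apply ext_pair
  intro u p
  rw [pair_eq_comp, pair_eq_comp]
  congr 1
  apply ext_pair₃'
  intro x y z
  rw [← pair_eq_comp, ← pair_eq_comp, pair_braiding_assoc, pair_braiding_assoc, h]

lemma ext_tensorRight {W Z T : V} {f g : W ⊗ Z ⟶ T}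
    (h : ∀ z : 𝟙_ V ⟶ Z, W ◁ z ≫ f = W ◁ z ≫ g) : f = g := by
  apply ext_pair
  intro x y
  have := congr(pair x (𝟙 _) ≫ $(h y))
  simpa [← Category.assoc, pair_whiskerLeft] using this


variable [HasCoequalizers V]

/-- The monoidal category of `R`-`R`-bimodules. -/
noncomputable instance bimodMonoidal (R : Mon V) : MonoidalCategory (Bimod R R) where
  tensorObj M N := M.tensorBimod N
  whiskerLeft M _ _ f := Bimod.whiskerLeft M f
  whiskerRight f N := Bimod.whiskerRight f N
  tensorUnit := Bimod.regular R
  associator := Bimod.associatorBimod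
  leftUnitor := Bimod.leftUnitorBimod
  rightUnitor := Bimod.rightUnitorBimod
  whiskerLeft_id _ _ := Bimod.whiskerLeft_id_bimod
  id_whiskerRight _ _ := Bimod.id_whiskerRight_bimod
  id_tensorHom_id M N := by
    beta_reduce
    rw [Bimod.id_whiskerRight_bimod, Bimod.whiskerLeft_id_bimod, Category.id_comp]
  tensorHom_comp_tensorHom f₁ f₂ g₁ g₂ := by
    beta_reduce
    rw [Bimod.comp_whiskerRight_bimod, Bimod.whiskerLeft_comp_bimod, Category.assoc,
      Category.assoc]
    congr 1
    rw [← Category.assoc, Bimod.whisker_exchange_bimod, Category.assoc]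
  associator_naturality {X₁ X₂ X₃ Y₁ Y₂ Y₃} f₁ f₂ f₃ := by
    beta_reduce
    rw [Bimod.comp_whiskerRight_bimod, Bimod.whiskerLeft_comp_bimod, Bimod.whisker_assoc_bimod,
      Bimod.comp_whiskerLeft_bimod, Bimod.whiskerRight_comp_bimod]
    simp
  leftUnitor_naturality {M N} f := by
    rw [Bimod.id_whiskerLeft_bimod]; simp
  rightUnitor_naturality {M N} f := by
    rw [Bimod.whiskerRight_id_bimod]; simp
  pentagon M N P Q := Bimod.pentagon_bimod M N P Q
  triangle M N := Bimod.triangle_bimod M N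



/-- The canonical projection `M ⊗ N ⟶ M ⊗_R N`. -/
noncomputable def proj {R : Mon V} (M N : Bimod R R) :
    M.X ⊗ N.X ⟶ (M ⊗ N).X := coequalizer.π _ _

lemma proj_condition {R : Mon V} (M N : Bimod R R) :
    M.actRight ▷ N.X ≫ proj M N = (α_ _ _ _).hom ≫ M.X ◁ N.actLeft ≫ proj M N := by
  have := coequalizer.condition (M.actRight ▷ N.X) ((α_ _ _ _).hom ≫ (M.X ◁ N.actLeft))
  rw [Category.assoc] at this
  exact this

lemma pair_proj {R : Mon V} (M N : Bimod R R) (x : 𝟙_ V ⟶ M.X)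
    (r : 𝟙_ V ⟶ R.X) (y : 𝟙_ V ⟶ N.X) :
    pair (pair x r ≫ M.actRight) y ≫ proj M N = pair x (pair r y ≫ N.actLeft) ≫ proj M N := by
  have := congr(pair (pair x r) y ≫ $(proj_condition M N))
  simpa only [pair_whiskerRight_assoc, pair_associator_assoc, pair_whiskerLeft_assoc] using this

instance {R : Mon V} (M N : Bimod R R) : Epi (proj M N) :=
  inferInstanceAs (Epi (coequalizer.π _ _))

lemma proj_ext {R : Mon V} {M N : Bimod R R} {Z : V}
    {f g : (M ⊗ N).X ⟶ Z}
    (h : ∀ x y, pair x y ≫ proj M N ≫ f = pair x y ≫ proj M N ≫ g) : f = g := by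
  rw [← cancel_epi (proj M N)]
  exact ext_pair h

lemma whiskerLeft_proj_ext {R : Mon V} {M N : Bimod R R} {Z W : V}
    {f g : Z ⊗ (M ⊗ N).X ⟶ W}
    (h : ∀ z x y, pair z (pair x y ≫ proj M N) ≫ f = pair z (pair x y ≫ proj M N) ≫ g) :
    f = g := by
  apply ext_left
  intro z
  rw [← cancel_epi (λ_ _).inv]
  apply proj_ext
  intro x y
  have e : pair x y ≫ proj M N ≫ (λ_ _).inv ≫ z ▷ _ = pair z (pair x y ≫ proj M N) := by
    have := comp_leftUnitor_inv (pair x y ≫ proj M N)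
    simp only [Category.assoc] at this
    simp only [reassoc_of% this, pair_whiskerRight, Category.id_comp]
  have h' := h z x y
  rw [← e] at h'
  simpa only [Category.assoc] using h'

lemma proj_whiskerRight_ext {R : Mon V} {M N : Bimod R R} {Z W : V}
    {f g : (M ⊗ N).X ⊗ Z ⟶ W}
    (h : ∀ x y z, pair (pair x y ≫ proj M N) z ≫ f = pair (pair x y ≫ proj M N) z ≫ g) :
    f = g := by
  rw [← cancel_epi (β_ _ _).hom]
  apply whiskerLeft_proj_ext
  intro z x y
  rw [pair_braiding_assoc, pair_braiding_assoc, h]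

lemma pair_eq_comp' {X Y W : V} (x : 𝟙_ V ⟶ X) (y : 𝟙_ V ⟶ Y) (f : X ⊗ Y ⟶ W) :
    pair x y ≫ f = x ≫ (ρ_ X).inv ≫ X ◁ y ≫ f := by
  rw [← Category.assoc x, comp_rightUnitor_inv, pair_whiskerLeft_assoc, Category.id_comp]

lemma proj_ext_pair {R : Mon V} {M N : Bimod R R} {Z U W : V}
    {f g : (M ⊗ N).X ⊗ (Z ⊗ U) ⟶ W}
    (h : ∀ x y z u, pair (pair x y ≫ proj M N) (pair z u) ≫ f =
      pair (pair x y ≫ proj M N) (pair z u) ≫ g) : f = g := by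
  apply proj_whiskerRight_ext
  intro x y z
  rw [pair_eq_comp (pair x y ≫ proj M N), pair_eq_comp (pair x y ≫ proj M N)]
  congr 1
  apply ext_pair
  intro z u
  rw [← pair_eq_comp, ← pair_eq_comp, h]

lemma proj_ext₃ {R : Mon V} {P L : Bimod R R} {X Y Z W : V} (q : X ⊗ Y ⟶ P.X) [Epi q]
    {f g : (P ⊗ L).X ⊗ Z ⟶ W}
    (h : ∀ x y l z, pair (pair (pair x y ≫ q) l ≫ proj P L) z ≫ f =
      pair (pair (pair x y ≫ q) l ≫ proj P L) z ≫ g) : f = g := by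
  apply proj_whiskerRight_ext
  intro p l z
  have e : ∀ (p : 𝟙_ V ⟶ P.X) (k : (P ⊗ L).X ⊗ Z ⟶ W), pair (pair p l ≫ proj P L) z ≫ k =
      p ≫ (ρ_ _).inv ≫ P.X ◁ l ≫ proj P L ≫ (ρ_ _).inv ≫ _ ◁ z ≫ k := by
    intro p k
    rw [pair_eq_comp', Category.assoc, pair_eq_comp']
  rw [e, e]
  congr 1
  rw [← cancel_epi q]
  apply ext_pair
  intro x y
  rw [← Category.assoc, ← Category.assoc (pair x y), ← e, ← e, h]

section
variable {R : Mon V}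

lemma proj_whiskerLeft (M : Bimod R R) {N N' : Bimod R R} (f : N ⟶ N') :
    proj M N ≫ (M ◁ f).hom = M.X ◁ f.hom ≫ proj M N' := by
  erw [ι_colimMap]; rfl

lemma proj_whiskerRight {M M' : Bimod R R} (f : M ⟶ M') (N : Bimod R R) :
    proj M N ≫ (f ▷ N).hom = f.hom ▷ N.X ≫ proj M' N := by
  erw [ι_colimMap]; rfl

lemma proj_tensorHom {M M' N N' : Bimod R R} (f : M ⟶ M') (g : N ⟶ N') :
    proj M N ≫ (f ⊗ₘ g).hom = (f.hom ⊗ₘ g.hom) ≫ proj M' N' := by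
  rw [MonoidalCategory.tensorHom_def, Bimod.comp_hom', ← Category.assoc, proj_whiskerRight,
    Category.assoc, proj_whiskerLeft, MonoidalCategory.tensorHom_def, Category.assoc]

lemma proj_actLeft (M N : Bimod R R) :
    R.X ◁ proj M N ≫ (M ⊗ N).actLeft = (α_ _ _ _).inv ≫ M.actLeft ▷ N.X ≫ proj M N :=
  Bimod.TensorBimod.whiskerLeft_π_actLeft M N

lemma proj_actRight (M N : Bimod R R) :
    proj M N ▷ R.X ≫ (M ⊗ N).actRight = (α_ _ _ _).hom ≫ M.X ◁ N.actRight ≫ proj M N :=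
  Bimod.TensorBimod.π_tensor_id_actRight M N

lemma proj_leftUnitor (M : Bimod R R) : proj (Bimod.regular R) M ≫ (λ_ M).hom.hom = M.actLeft :=
  coequalizer.π_desc _ _

lemma proj_rightUnitor (M : Bimod R R) : proj M (Bimod.regular R) ≫ (ρ_ M).hom.hom = M.actRight :=
  coequalizer.π_desc _ _

lemma proj_associator (M N P : Bimod R R) :
    proj M N ▷ P.X ≫ proj (M ⊗ N) P ≫ (α_ M N P).hom.hom =
      (α_ _ _ _).hom ≫ M.X ◁ proj N P ≫ proj M (N ⊗ P) := by
  have e : proj (M ⊗ N) P ≫ (α_ M N P).hom.hom = Bimod.AssociatorBimod.homAux M N P :=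
    coequalizer.π_desc _ _
  rw [e]
  exact π_tensor_id_preserves_coequalizer_inv_desc _ _ _ _

end

section
variable {R : Mon V} {M N : Bimod R R}

lemma pair_actLeft_hom (f : M ⟶ N) (r : 𝟙_ V ⟶ R.X) (x : 𝟙_ V ⟶ M.X) :
    pair r x ≫ M.actLeft ≫ f.hom = pair r (x ≫ f.hom) ≫ N.actLeft := by
  rw [f.left_act_hom, pair_whiskerLeft_assoc]

lemma pair_actRight_hom (f : M ⟶ N) (r : 𝟙_ V ⟶ R.X) (x : 𝟙_ V ⟶ M.X) :
    pair x r ≫ M.actRight ≫ f.hom = pair (x ≫ f.hom) r ≫ N.actRight := by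
  rw [f.right_act_hom, pair_whiskerRight_assoc]

lemma pair_proj_actLeft (r : 𝟙_ V ⟶ R.X) (x : 𝟙_ V ⟶ M.X) (y : 𝟙_ V ⟶ N.X) :
    pair r (pair x y ≫ proj M N) ≫ (M ⊗ N).actLeft =
      pair (pair r x ≫ M.actLeft) y ≫ proj M N := by
  rw [← pair_whiskerLeft, Category.assoc, proj_actLeft, pair_associator_inv_assoc,
    pair_whiskerRight_assoc]

lemma pair_proj_actRight (r : 𝟙_ V ⟶ R.X) (x : 𝟙_ V ⟶ M.X) (y : 𝟙_ V ⟶ N.X) :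
    pair (pair x y ≫ proj M N) r ≫ (M ⊗ N).actRight =
      pair x (pair y r ≫ N.actRight) ≫ proj M N := by
  rw [← pair_whiskerRight, Category.assoc, proj_actRight, pair_associator_assoc,
    pair_whiskerLeft_assoc]

end

/-- The lax monoidal forgetful functor `Γ^R` from `R`-`R`-bimodules to `V`; its comparison arrows
are the unit of `R` and the projections `M ⊗ N ⟶ M ⊗_R N`. -/
def bimodForget (R : Mon V) : Bimod R R ⥤ V := Bimod.forget R

noncomputable instance (R : Mon V) : (bimodForget R).LaxMonoidal where
  ε := MonObj.one (X := R.X)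
  μ M N := proj M N
  μ_natural_left f N := (proj_whiskerRight f N).symm
  μ_natural_right M f := (proj_whiskerLeft M f).symm
  associativity M N P := proj_associator M N P
  left_unitality M := by
    have := proj_leftUnitor M
    exact (M.one_actLeft.symm.trans congr(_ ≫ $(this.symm)))
  right_unitality M := by
    have := proj_rightUnitor M
    exact (M.actRight_one.symm.trans congr(_ ≫ $(this.symm)))


/-- A right module over a monoid `A`. -/
structure RightModule (A : Mon V) where
  X : V
  act : X ⊗ A.X ⟶ X
  act_one : X ◁ MonObj.one ≫ act = (ρ_ X).hom
  act_mul : X ◁ MonObj.mul ≫ act = (α_ X A.X A.X).inv ≫ act ▷ A.X ≫ act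

namespace RightModule
variable {A : Mon V}

/-- A morphism of right `A`-modules. -/
@[ext]
structure Hom (X Y : RightModule A) where
  hom : X.X ⟶ Y.X
  act_hom : X.act ≫ hom = hom ▷ A.X ≫ Y.act

instance : Category (RightModule A) where
  Hom X Y := Hom X Y
  id X := ⟨𝟙 X.X, by simp⟩
  comp f g := ⟨f.hom ≫ g.hom, by
    rw [← Category.assoc, f.act_hom, Category.assoc, g.act_hom, comp_whiskerRight, Category.assoc]⟩

@[ext]
lemma hom_ext {X Y : RightModule A} {f g : X ⟶ Y} (h : f.hom = g.hom) : f = g := Hom.ext h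

@[simp] lemma id_hom (X : RightModule A) : Hom.hom (𝟙 X) = 𝟙 X.X := rfl
@[simp] lemma comp_hom {X Y Z : RightModule A} (f : X ⟶ Y) (g : Y ⟶ Z) :
    (f ≫ g).hom = f.hom ≫ g.hom := rfl

/-- An isomorphism in `V` that is compatible with the actions is one of right modules. -/
@[simps]
def isoMk {X Y : RightModule A} (e : X.X ≅ Y.X) (h : X.act ≫ e.hom = e.hom ▷ A.X ≫ Y.act) :
    X ≅ Y where
  hom := ⟨e.hom, h⟩
  inv := ⟨e.inv, by
    rw [← cancel_mono e.hom, Category.assoc, Category.assoc, h, e.inv_hom_id,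
      Category.comp_id, ← Category.assoc, ← comp_whiskerRight, e.inv_hom_id, id_whiskerRight,
      Category.id_comp]⟩

variable (A) in
/-- The regular right module. -/
abbrev regular : RightModule A where
  X := A.X
  act := MonObj.mul
  act_one := MonObj.mul_one A.X
  act_mul := by rw [MonObj.mul_assoc, Iso.inv_hom_id_assoc]

lemma pair_act_one (X : RightModule A) (x : 𝟙_ V ⟶ X.X) :
    pair x MonObj.one ≫ X.act = x := by
  have h := congr(x ≫ (ρ_ _).inv ≫ $(X.act_one))
  rw [← Category.assoc, comp_rightUnitor_inv, pair_whiskerLeft_assoc] at h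
  simpa using h

lemma pair_act_mul (X : RightModule A) (x : 𝟙_ V ⟶ X.X) (a b : 𝟙_ V ⟶ A.X) :
    pair (pair x a ≫ X.act) b ≫ X.act = pair x (pair a b ≫ MonObj.mul) ≫ X.act := by
  have h := congr(pair x (pair a b) ≫ $(X.act_mul))
  rw [pair_whiskerLeft_assoc, pair_associator_inv_assoc, pair_whiskerRight_assoc] at h
  exact h.symm

/-- A right module, with the module axioms checked on elements. -/
abbrev ofElements (X : V) (act : X ⊗ A.X ⟶ X)
    (one : ∀ x : 𝟙_ V ⟶ X, pair x MonObj.one ≫ act = x)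
    (mul : ∀ (x : 𝟙_ V ⟶ X) (a b : 𝟙_ V ⟶ A.X),
      pair (pair x a ≫ act) b ≫ act = pair x (pair a b ≫ MonObj.mul) ≫ act) :
    RightModule A where
  X := X
  act := act
  act_one := by
    rw [← cancel_epi (ρ_ X).inv]
    apply ext_one
    intro x
    rw [← Category.assoc, comp_rightUnitor_inv, pair_whiskerLeft_assoc, Category.id_comp, one]
    simp
  act_mul := by
    apply ext_pair₃
    intro x a b
    rw [pair_whiskerLeft_assoc, pair_associator_inv_assoc, pair_whiskerRight_assoc, mul]

lemma pair_hom {X Y : RightModule A} (f : X ⟶ Y) (x : 𝟙_ V ⟶ X.X) (a : 𝟙_ V ⟶ A.X) :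
    pair x a ≫ X.act ≫ f.hom = pair (x ≫ f.hom) a ≫ Y.act := by
  rw [f.act_hom, pair_whiskerRight_assoc]

/-- The morphism of right modules `A ⟶ X`, `a ↦ x a`. -/
def orbit {X : RightModule A} (x : 𝟙_ V ⟶ X.X) : regular A ⟶ X where
  hom := (λ_ A.X).inv ≫ x ▷ A.X ≫ X.act
  act_hom := by
    apply ext_pair
    intro a b
    have e : ∀ c : 𝟙_ V ⟶ A.X, c ≫ (λ_ A.X).inv ≫ x ▷ A.X ≫ X.act = pair x c ≫ X.act := by
      intro c
      rw [← Category.assoc, comp_leftUnitor_inv, pair_whiskerRight_assoc, Category.id_comp]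
    have := e (pair a b ≫ MonObj.mul)
    rw [Category.assoc] at this
    refine this.trans ?_
    rw [pair_whiskerRight_assoc]
    refine Eq.trans ?_ congr(pair $((e a).symm) b ≫ X.act)
    exact (pair_act_mul _ _ _ _).symm

lemma comp_orbit {X : RightModule A} (x : 𝟙_ V ⟶ X.X) (a : 𝟙_ V ⟶ A.X) :
    a ≫ (orbit x).hom = pair x a ≫ X.act := by
  change a ≫ (λ_ A.X).inv ≫ x ▷ A.X ≫ X.act = _
  rw [← Category.assoc, comp_leftUnitor_inv, pair_whiskerRight_assoc, Category.id_comp]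

lemma orbit_comp {X Y : RightModule A} (x : 𝟙_ V ⟶ X.X) (f : X ⟶ Y) :
    orbit x ≫ f = orbit (x ≫ f.hom) := by
  ext
  apply ext_one
  intro a
  rw [comp_hom, comp_orbit, ← pair_hom, ← Category.assoc, ← Category.assoc]
  congr 1
  exact comp_orbit x a

variable (A) in
/-- The forgetful functor from right `A`-modules to `V`. -/
@[simps]
def forget : RightModule A ⥤ V where
  obj X := X.X
  map f := f.hom

instance : (forget A).Faithful where
  map_injective h := hom_ext h

end RightModule


variable (V) in
/-- A monoid `A` with monoid morphisms `s : R ⟶ A` and `t : R^op ⟶ A` the images of which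
commute with each other: `s(r) t(r') = t(r') s(r)`. -/
structure SourceTargetRing where
  R : Mon V
  A : Mon V
  s : R ⟶ A
  t : R.X ⟶ A.X
  one_t : MonObj.one ≫ t = MonObj.one
  mul_t : MonObj.mul ≫ t = (β_ R.X R.X).hom ≫ (t ⊗ₘ t) ≫ MonObj.mul
  comm : (s.hom ⊗ₘ t) ≫ MonObj.mul = (β_ R.X R.X).hom ≫ (t ⊗ₘ s.hom) ≫ MonObj.mul

namespace SourceTargetRing
variable (B : SourceTargetRing V)

lemma pair_one_s : MonObj.one ≫ B.s.hom = MonObj.one := IsMonHom.one_hom B.s.hom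

lemma pair_mul_s (r r' : 𝟙_ V ⟶ B.R.X) : pair r r' ≫ MonObj.mul ≫ B.s.hom =
    pair (r ≫ B.s.hom) (r' ≫ B.s.hom) ≫ MonObj.mul := by
  rw [IsMonHom.mul_hom B.s.hom, pair_tensorHom_assoc]

lemma pair_mul_t (r r' : 𝟙_ V ⟶ B.R.X) : pair r r' ≫ MonObj.mul ≫ B.t =
    pair (r' ≫ B.t) (r ≫ B.t) ≫ MonObj.mul := by
  rw [B.mul_t, pair_braiding_assoc, pair_tensorHom_assoc]

lemma pair_comm (r r' : 𝟙_ V ⟶ B.R.X) :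
    pair (r ≫ B.s.hom) (r' ≫ B.t) ≫ MonObj.mul =
      pair (r' ≫ B.t) (r ≫ B.s.hom) ≫ MonObj.mul := by
  have := congr(pair r r' ≫ $(B.comm))
  rwa [pair_braiding_assoc, pair_tensorHom_assoc, pair_tensorHom_assoc] at this

/-- A right `A`-module as an `R`-`R`-bimodule, `r · x = x t(r)` and `x · r = x s(r)`. -/
abbrev restrictObj (X : RightModule B.A) : Bimod B.R B.R where
  X := X.X
  actLeft := (β_ B.R.X X.X).hom ≫ X.X ◁ B.t ≫ X.act
  actRight := X.X ◁ B.s.hom ≫ X.act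
  one_actLeft := by
    rw [← cancel_epi (λ_ _).inv]
    apply ext_one
    intro x
    rw [← Category.assoc, comp_leftUnitor_inv, pair_whiskerRight_assoc, pair_braiding_assoc,
      pair_whiskerLeft_assoc, Category.id_comp, B.one_t, X.pair_act_one]
    simp
  actRight_one := by
    rw [← cancel_epi (ρ_ _).inv]
    apply ext_one
    intro x
    rw [← Category.assoc, comp_rightUnitor_inv, pair_whiskerLeft_assoc,
      pair_whiskerLeft_assoc, Category.id_comp, B.pair_one_s, X.pair_act_one]
    simp
  left_assoc := by
    apply ext_pair₃'
    intro r r' x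
    rw [pair_whiskerRight_assoc, pair_braiding_assoc, pair_whiskerLeft_assoc, Category.assoc,
      pair_mul_t, pair_associator_assoc, pair_whiskerLeft_assoc, pair_braiding_assoc,
      pair_whiskerLeft_assoc, pair_braiding_assoc, pair_whiskerLeft_assoc, X.pair_act_mul]
  right_assoc := by
    apply ext_pair₃
    intro x r r'
    rw [pair_whiskerLeft_assoc, pair_whiskerLeft_assoc, Category.assoc, pair_mul_s,
      pair_associator_inv_assoc, pair_whiskerRight_assoc, pair_whiskerLeft_assoc,
      pair_whiskerLeft_assoc, X.pair_act_mul]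
  middle_assoc := by
    apply ext_pair₃'
    intro r x r'
    rw [pair_whiskerRight_assoc, pair_whiskerLeft_assoc, pair_braiding_assoc,
      pair_whiskerLeft_assoc, X.pair_act_mul, pair_associator_assoc, pair_whiskerLeft_assoc,
      pair_braiding_assoc, pair_whiskerLeft_assoc, pair_whiskerLeft_assoc, X.pair_act_mul,
      pair_comm]

lemma pair_actLeft (X : RightModule B.A) (r : 𝟙_ V ⟶ B.R.X) (x : 𝟙_ V ⟶ X.X) :
    pair r x ≫ (B.restrictObj X).actLeft = pair x (r ≫ B.t) ≫ X.act := by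
  rw [pair_braiding_assoc, pair_whiskerLeft_assoc]

lemma pair_actRight (X : RightModule B.A) (r : 𝟙_ V ⟶ B.R.X) (x : 𝟙_ V ⟶ X.X) :
    pair x r ≫ (B.restrictObj X).actRight = pair x (r ≫ B.s.hom) ≫ X.act := by
  rw [pair_whiskerLeft_assoc]

/-- A morphism of right `A`-modules as a morphism of `R`-`R`-bimodules. -/
abbrev restrictMap {X Y : RightModule B.A} (f : X ⟶ Y) : B.restrictObj X ⟶ B.restrictObj Y where
  hom := f.hom
  left_act_hom := by
    apply ext_pair
    intro r x
    rw [← Category.assoc, pair_actLeft, Category.assoc, RightModule.pair_hom,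
      pair_whiskerLeft_assoc, pair_actLeft]
  right_act_hom := by
    apply ext_pair
    intro x r
    rw [← Category.assoc, pair_actRight, Category.assoc, RightModule.pair_hom,
      pair_whiskerRight_assoc, pair_actRight]

/-- The restriction functor from right `A`-modules to `R`-`R`-bimodules. -/
abbrev restrict : RightModule B.A ⥤ Bimod B.R B.R where
  obj X := B.restrictObj X
  map f := B.restrictMap f

instance : B.restrict.Faithful where
  map_injective h := RightModule.hom_ext congr(($h).hom)

/-- The `R`-`R`-bimodule `A`, with `r · a = a t(r)` and `a · r = a s(r)`. -/
abbrev bimod : Bimod B.R B.R := B.restrictObj (RightModule.regular B.A)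

/-- Left multiplication `b ↦ a b` by an element `a` of `A`, as a bimodule morphism `A ⟶ A`. -/
def mulLeft (a : 𝟙_ V ⟶ B.A.X) : B.bimod ⟶ B.bimod :=
  B.restrictMap (RightModule.orbit (X := RightModule.regular B.A) a)

/-- The bimodule morphism `A ⟶ X`, `a ↦ x a`. -/
def orbit {X : RightModule B.A} (x : 𝟙_ V ⟶ X.X) : B.bimod ⟶ B.restrictObj X :=
  B.restrictMap (RightModule.orbit x)

lemma comp_orbit {X : RightModule B.A} (x : 𝟙_ V ⟶ X.X) (a : 𝟙_ V ⟶ B.A.X) :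
    a ≫ (B.orbit x).hom = pair x a ≫ X.act := RightModule.comp_orbit x a

lemma mulLeft_orbit {X : RightModule B.A} (x : 𝟙_ V ⟶ X.X) (a : 𝟙_ V ⟶ B.A.X) :
    B.mulLeft a ≫ B.orbit x = B.orbit (pair x a ≫ X.act) := by
  refine (B.restrict.map_comp _ _).symm.trans ?_
  rw [RightModule.orbit_comp, RightModule.comp_orbit]; rfl

end SourceTargetRing

variable (V) in
/-- A monoid `A` over `R` with a bimodule morphism `δ : A ⟶ A ⊗_R A`, `δ(a) = a₁ ⊗ a₂`, that
satisfies the Takeuchi condition `s(r) a₁ ⊗ a₂ = a₁ ⊗ t(r) a₂` for all elements `r` of `R`. -/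
structure PreBialgebroid extends SourceTargetRing V where
  comul : toSourceTargetRing.bimod ⟶ toSourceTargetRing.bimod ⊗ toSourceTargetRing.bimod
  takeuchi : ∀ r : 𝟙_ V ⟶ R.X,
    comul ≫ toSourceTargetRing.mulLeft (r ≫ s.hom) ▷ toSourceTargetRing.bimod =
      comul ≫ toSourceTargetRing.bimod ◁ toSourceTargetRing.mulLeft (r ≫ t)

namespace PreBialgebroid
variable (B : PreBialgebroid V) (X Y : RightModule B.A)

/-- The morphism `x ⊗ y ⊗ (a ⊗_R b) ↦ x a ⊗_R y b`. -/
noncomputable def tensorActAux :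
    (X.X ⊗ Y.X) ⊗ (B.bimod ⊗ B.bimod).X ⟶ (B.restrictObj X ⊗ B.restrictObj Y).X :=
  (PreservesCoequalizer.iso (tensorLeft (X.X ⊗ Y.X)) _ _).inv ≫
    coequalizer.desc
      (tensorμ X.X Y.X B.A.X B.A.X ≫ (X.act ⊗ₘ Y.act) ≫ proj (B.restrictObj X) (B.restrictObj Y))
      (by
        apply ext_pair₅
        intro x y a r b
        refine (pair_whiskerLeft_assoc _ _ _ _).trans
          (Eq.trans ?_ (pair_whiskerLeft_assoc _ _ _ _).symm)
        have e₁ : pair a r ≫ B.bimod.actRight = _ := B.pair_actRight (RightModule.regular B.A) r a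
        have e₂ : pair r b ≫ B.bimod.actLeft = _ := B.pair_actLeft (RightModule.regular B.A) r b
        rw [pair_whiskerRight,
          ← Category.assoc (pair _ b), pair_associator, pair_whiskerLeft,
          e₁, e₂, pair_tensorμ_assoc, pair_tensorμ_assoc,
          pair_tensorHom_assoc, pair_tensorHom_assoc, ← X.pair_act_mul, ← Y.pair_act_mul,
          ← B.pair_actRight X, ← B.pair_actLeft Y]
        exact pair_proj (B.restrictObj X) (B.restrictObj Y) _ r _)

lemma pair_proj_tensorActAux (x : 𝟙_ V ⟶ X.X) (y : 𝟙_ V ⟶ Y.X) (a b : 𝟙_ V ⟶ B.A.X) :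
    pair (pair x y) (pair a b ≫ proj B.bimod B.bimod) ≫ B.tensorActAux X Y =
      pair (pair x a ≫ X.act) (pair y b ≫ Y.act) ≫
        proj (B.restrictObj X) (B.restrictObj Y) := by
  have e : (X.X ⊗ Y.X) ◁ proj B.bimod B.bimod ≫ B.tensorActAux X Y = _ :=
    id_tensor_π_preserves_coequalizer_inv_desc _ _ _ _
  rw [← pair_whiskerLeft, Category.assoc, e, pair_tensorμ_assoc, pair_tensorHom_assoc]

lemma pair_tensorActAux (x : 𝟙_ V ⟶ X.X) (y : 𝟙_ V ⟶ Y.X) (z : 𝟙_ V ⟶ (B.bimod ⊗ B.bimod).X) :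
    pair (pair x y) z ≫ B.tensorActAux X Y = z ≫ (B.orbit x ⊗ₘ B.orbit y).hom := by
  rw [pair_eq_comp]
  congr 1
  apply proj_ext
  intro a b
  rw [proj_tensorHom, pair_tensorHom_assoc, B.comp_orbit, B.comp_orbit,
    ← B.pair_proj_tensorActAux, pair_eq_comp (pair x y), Category.assoc]

/-- The diagonal action `(x ⊗ y) a = x a₁ ⊗ y a₂` of `A` on `X ⊗_R Y`, which is well defined by the
Takeuchi condition. -/
noncomputable def tensorAct :
    (B.restrictObj X ⊗ B.restrictObj Y).X ⊗ B.A.X ⟶ (B.restrictObj X ⊗ B.restrictObj Y).X :=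
  (PreservesCoequalizer.iso (tensorRight B.A.X) _ _).inv ≫
    coequalizer.desc ((X.X ⊗ Y.X) ◁ B.comul.hom ≫ B.tensorActAux X Y)
      (by
        apply ext_pair₄
        intro x r y a
        refine (pair_whiskerRight_assoc _ _ _ _).trans
          (Eq.trans ?_ (pair_whiskerRight_assoc _ _ _ _).symm)
        rw [pair_whiskerRight,
          ← Category.assoc (pair _ y), pair_associator, pair_whiskerLeft,
          B.pair_actRight, B.pair_actLeft, pair_whiskerLeft_assoc, pair_whiskerLeft_assoc,
          pair_tensorActAux, pair_tensorActAux, ← B.mulLeft_orbit, ← B.mulLeft_orbit]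
        have h := congr(a ≫ ($(B.takeuchi r) ≫ (B.orbit x ⊗ₘ B.orbit y)).hom)
        simpa [← tensorHom_id, ← id_tensorHom, tensorHom_comp_tensorHom] using h)

lemma pair_tensorAct (x : 𝟙_ V ⟶ X.X) (y : 𝟙_ V ⟶ Y.X) (a : 𝟙_ V ⟶ B.A.X) :
    pair (pair x y ≫ proj (B.restrictObj X) (B.restrictObj Y)) a ≫ B.tensorAct X Y =
      a ≫ (B.comul ≫ (B.orbit x ⊗ₘ B.orbit y)).hom := by
  have e : proj (B.restrictObj X) (B.restrictObj Y) ▷ B.A.X ≫ B.tensorAct X Y = _ :=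
    π_tensor_id_preserves_coequalizer_inv_desc _ _ _ _
  rw [← pair_whiskerRight, Category.assoc, e, pair_whiskerLeft_assoc, pair_tensorActAux,
    Category.assoc, Bimod.comp_hom']


lemma comp_tensorAct (X : RightModule B.A) (Y : RightModule B.A)
    {X' Y' : RightModule B.A} (f : X ⟶ X') (g : Y ⟶ Y') :
    B.tensorAct X Y ≫ (B.restrictMap f ⊗ₘ B.restrictMap g).hom =
      (B.restrictMap f ⊗ₘ B.restrictMap g).hom ▷ B.A.X ≫ B.tensorAct X' Y' := by
  apply proj_whiskerRight_ext
  intro x y a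
  have ef : B.orbit x ≫ B.restrictMap f = B.orbit (x ≫ f.hom) :=
    (B.restrict.map_comp _ _).symm.trans congr(B.restrict.map $(RightModule.orbit_comp x f))
  have eg : B.orbit y ≫ B.restrictMap g = B.orbit (y ≫ g.hom) :=
    (B.restrict.map_comp _ _).symm.trans congr(B.restrict.map $(RightModule.orbit_comp y g))
  have e : (pair x y ≫ proj (B.restrictObj X) (B.restrictObj Y)) ≫
      (B.restrictMap f ⊗ₘ B.restrictMap g).hom =
      pair (x ≫ f.hom) (y ≫ g.hom) ≫ proj (B.restrictObj X') (B.restrictObj Y') := by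
    rw [Category.assoc, proj_tensorHom, pair_tensorHom_assoc]
  have e' : (B.comul ≫ (B.orbit x ⊗ₘ B.orbit y)) ≫ (B.restrictMap f ⊗ₘ B.restrictMap g) =
      B.comul ≫ (B.orbit (x ≫ f.hom) ⊗ₘ B.orbit (y ≫ g.hom)) := by
    rw [Category.assoc, tensorHom_comp_tensorHom, ef, eg]
  rw [← Category.assoc, B.pair_tensorAct, Category.assoc, pair_whiskerRight_assoc, e,
    B.pair_tensorAct, ← e', Bimod.comp_hom', Bimod.comp_hom' (B.comul ≫ _), Bimod.comp_hom']

end PreBialgebroid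

section
variable {D : Type*} [Category* D] [MonoidalCategory D]

lemma assoc_aux {C X Y Z XY YZ XYZ XYZ' : D} {δ : C ⟶ C ⊗ C}
    (h : δ ≫ δ ▷ C ≫ (α_ _ _ _).hom = δ ≫ C ◁ δ) (x : C ⟶ X) (y : C ⟶ Y) (z : C ⟶ Z)
    (i : X ⊗ Y ≅ XY) (j : XY ⊗ Z ≅ XYZ) (i' : Y ⊗ Z ≅ YZ) (j' : X ⊗ YZ ≅ XYZ') :
    δ ≫ (δ ≫ (x ⊗ₘ y) ≫ i.hom ⊗ₘ z) ≫ j.hom ≫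
      ((j.symm ≪≫ (i.symm ⊗ᵢ .refl Z)) ≪≫ α_ X Y Z ≪≫ ((.refl X ⊗ᵢ i') ≪≫ j')).hom =
    δ ≫ (x ⊗ₘ (δ ≫ (y ⊗ₘ z) ≫ i'.hom)) ≫ j'.hom := by
  have e : (δ ≫ (x ⊗ₘ y) ≫ i.hom) ⊗ₘ z = δ ▷ C ≫ ((x ⊗ₘ y) ⊗ₘ z) ≫ i.hom ▷ Z := by
    rw [← tensorHom_id, ← tensorHom_id, tensorHom_comp_tensorHom, tensorHom_comp_tensorHom]
    simp
  have e' : x ⊗ₘ (δ ≫ (y ⊗ₘ z) ≫ i'.hom) = C ◁ δ ≫ (x ⊗ₘ (y ⊗ₘ z)) ≫ X ◁ i'.hom := by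
    rw [← id_tensorHom, ← id_tensorHom, tensorHom_comp_tensorHom, tensorHom_comp_tensorHom]
    simp
  have h' := congr($h ≫ (x ⊗ₘ (y ⊗ₘ z)) ≫ X ◁ i'.hom ≫ j'.hom)
  rw [e, e']
  simp only [Category.assoc] at h' ⊢
  rw [← h']
  simp

lemma left_aux {C X U UX : D} {δ : C ⟶ C ⊗ C} {ε : C ⟶ 𝟙_ D} (h : δ ≫ ε ▷ C = (λ_ C).inv)
    {m m' : C ⟶ C} (hm : δ ≫ m ▷ C = δ ≫ C ◁ m') (x : C ⟶ X) (u : C ⟶ U) (e : 𝟙_ D ≅ U)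
    (j : U ⊗ X ≅ UX) (hu : u ≫ e.inv = m ≫ ε) :
    δ ≫ (u ⊗ₘ x) ≫ j.hom ≫ ((j.symm ≪≫ (e.symm ⊗ᵢ .refl X)) ≪≫ λ_ X).hom = m' ≫ x := by
  have h₁ : (u ⊗ₘ x) ≫ e.inv ▷ X = m ▷ C ≫ (ε ⊗ₘ x) := by
    rw [← tensorHom_id, ← tensorHom_id, tensorHom_comp_tensorHom, tensorHom_comp_tensorHom, hu]
    simp
  have h₂ : C ◁ m' ≫ (ε ⊗ₘ x) = ε ▷ C ≫ 𝟙_ D ◁ (m' ≫ x) := by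
    rw [← tensorHom_id, ← id_tensorHom, ← id_tensorHom, tensorHom_comp_tensorHom,
      tensorHom_comp_tensorHom]
    simp
  have h₃ : δ ≫ ((u ⊗ₘ x) ≫ e.inv ▷ X) ≫ (λ_ X).hom = m' ≫ x := by
    rw [h₁, Category.assoc, ← Category.assoc, hm, Category.assoc, ← Category.assoc (C ◁ m'), h₂,
      Category.assoc, ← Category.assoc, h]
    simp
  rw [← h₃]
  simp

lemma right_aux {C X U UX : D} {δ : C ⟶ C ⊗ C} {ε : C ⟶ 𝟙_ D} (h : δ ≫ C ◁ ε = (ρ_ C).inv)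
    {m m' : C ⟶ C} (hm : δ ≫ m ▷ C = δ ≫ C ◁ m') (x : C ⟶ X) (u : C ⟶ U) (e : 𝟙_ D ≅ U)
    (j : X ⊗ U ≅ UX) (hu : u ≫ e.inv = m' ≫ ε) :
    δ ≫ (x ⊗ₘ u) ≫ j.hom ≫ ((j.symm ≪≫ (.refl X ⊗ᵢ e.symm)) ≪≫ ρ_ X).hom = m ≫ x := by
  have h₁ : (x ⊗ₘ u) ≫ X ◁ e.inv = C ◁ m' ≫ (x ⊗ₘ ε) := by
    rw [← id_tensorHom, ← id_tensorHom, tensorHom_comp_tensorHom, tensorHom_comp_tensorHom, hu]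
    simp
  have h₂ : m ▷ C ≫ (x ⊗ₘ ε) = C ◁ ε ≫ (m ≫ x) ▷ 𝟙_ D := by
    rw [← tensorHom_id, ← id_tensorHom, ← tensorHom_id, tensorHom_comp_tensorHom,
      tensorHom_comp_tensorHom]
    simp
  have h₃ : δ ≫ ((x ⊗ₘ u) ≫ X ◁ e.inv) ≫ (ρ_ X).hom = m ≫ x := by
    rw [h₁, Category.assoc, ← Category.assoc, ← hm, Category.assoc, ← Category.assoc (m ▷ C), h₂,
      Category.assoc, ← Category.assoc, h]
    simp
  rw [← h₃]
  simp

end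

variable (V) in
/-- A right bialgebroid in `V`: a base monoid `R`, a total monoid `A`, monoid morphisms
`s : R ⟶ A` and `t : R^op ⟶ A` with commuting images, and a comonoid structure `(δ, ε)` on the
`R`-`R`-bimodule `A`, such that
* the Takeuchi condition `s(r) a₁ ⊗ a₂ = a₁ ⊗ t(r) a₂` holds,
* `δ` is unital and multiplicative: `δ(1) = 1 ⊗ 1` and `δ(a b) = a₁ b₁ ⊗ a₂ b₂` (the right hand side
  is the diagonal action of `b` on `δ(a)`),
* `ε(1) = 1` and `ε(s(ε(a)) b) = ε(a b) = ε(t(ε(a)) b)`. -/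
structure RightBialgebroid extends PreBialgebroid V where
  counit : toSourceTargetRing.bimod ⟶ 𝟙_ (Bimod R R)
  comul_counit : comul ≫ counit ▷ toSourceTargetRing.bimod = (λ_ toSourceTargetRing.bimod).inv
  counit_comul : comul ≫ toSourceTargetRing.bimod ◁ counit = (ρ_ toSourceTargetRing.bimod).inv
  coassoc : comul ≫ comul ▷ toSourceTargetRing.bimod ≫ (α_ _ _ _).hom =
    comul ≫ toSourceTargetRing.bimod ◁ comul
  one_comul : MonObj.one ≫ comul.hom = pair MonObj.one MonObj.one ≫
    proj toSourceTargetRing.bimod toSourceTargetRing.bimod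
  mul_comul : MonObj.mul ≫ comul.hom = comul.hom ▷ A.X ≫
    toPreBialgebroid.tensorAct (RightModule.regular A) (RightModule.regular A)
  one_counit : MonObj.one ≫ counit.hom = MonObj.one (X := R.X)
  s_counit : (counit.hom ≫ s.hom) ▷ A.X ≫ MonObj.mul ≫ counit.hom = MonObj.mul ≫ counit.hom
  t_counit : (counit.hom ≫ t) ▷ A.X ≫ MonObj.mul ≫ counit.hom = MonObj.mul ≫ counit.hom

namespace RightBialgebroid
variable (B : RightBialgebroid V)

/-- The tensor product `X ⊗_R Y` of right `A`-modules with the diagonal action. -/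
noncomputable abbrev tensorObj (X Y : RightModule B.A) : RightModule B.A where
  X := (B.restrictObj X ⊗ B.restrictObj Y).X
  act := B.tensorAct X Y
  act_one := by
    rw [← cancel_epi (ρ_ _).inv]
    apply proj_ext
    intro x y
    have e : (pair x y ≫ proj (B.restrictObj X) (B.restrictObj Y)) ≫ (ρ_ _).inv =
        pair (pair x y ≫ proj (B.restrictObj X) (B.restrictObj Y)) (𝟙 _) :=
      comp_rightUnitor_inv _
    rw [← Category.assoc, ← Category.assoc, e, pair_whiskerLeft_assoc, Category.id_comp,
      B.pair_tensorAct, Bimod.comp_hom', ← Category.assoc, B.one_comul, Category.assoc,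
      proj_tensorHom, pair_tensorHom_assoc, B.comp_orbit, B.comp_orbit, X.pair_act_one,
      Y.pair_act_one]
    simp
  act_mul := by
    apply proj_ext_pair
    intro x y a b
    have h := B.comp_tensorAct (RightModule.regular B.A) (RightModule.regular B.A)
      (RightModule.orbit x) (RightModule.orbit y)
    rw [pair_whiskerLeft_assoc, pair_associator_inv_assoc, pair_whiskerRight_assoc,
      B.pair_tensorAct, B.pair_tensorAct, Category.assoc, Bimod.comp_hom',
      ← Category.assoc MonObj.mul, B.mul_comul, Category.assoc]
    refine congr(pair a b ≫ B.comul.hom ▷ _ ≫ $h).trans ?_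
    rw [pair_whiskerRight_assoc, pair_whiskerRight_assoc, Category.assoc]
    rfl


lemma comp_t_comul (r : 𝟙_ V ⟶ B.R.X) :
    r ≫ B.t ≫ B.comul.hom = pair (r ≫ B.t) MonObj.one ≫ proj B.bimod B.bimod := by
  have h := pair_actLeft_hom B.comul r (MonObj.one (X := B.A.X))
  have e : pair r (MonObj.one (X := B.A.X)) ≫ B.bimod.actLeft = r ≫ B.t :=
    (B.pair_actLeft (RightModule.regular B.A) r MonObj.one).trans (pair_one_mul _ _)
  rw [← Category.assoc, e, Category.assoc] at h
  rw [h, B.one_comul, pair_proj_actLeft, e]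

lemma comp_s_comul (r : 𝟙_ V ⟶ B.R.X) :
    r ≫ B.s.hom ≫ B.comul.hom =
      pair MonObj.one (r ≫ B.s.hom) ≫ proj B.bimod B.bimod := by
  have h := pair_actRight_hom B.comul r (MonObj.one (X := B.A.X))
  have e : pair (MonObj.one (X := B.A.X)) r ≫ B.bimod.actRight = r ≫ B.s.hom :=
    (B.pair_actRight (RightModule.regular B.A) r MonObj.one).trans (pair_one_mul _ _)
  rw [← Category.assoc, e, Category.assoc] at h
  rw [h, B.one_comul, pair_proj_actRight, e]

/-- The counit as an arrow of `V`. -/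
def eps : B.A.X ⟶ B.R.X := B.counit.hom

lemma pair_actLeft_eps (r : 𝟙_ V ⟶ B.R.X) (a : 𝟙_ V ⟶ B.A.X) :
    pair a (r ≫ B.t) ≫ MonObj.mul ≫ B.eps = pair r (a ≫ B.eps) ≫ MonObj.mul := by
  rw [← Category.assoc]
  refine congr($((B.pair_actLeft (RightModule.regular B.A) r a).symm) ≫ B.eps).trans ?_
  rw [Category.assoc]
  exact pair_actLeft_hom B.counit r a

lemma pair_actRight_eps (r : 𝟙_ V ⟶ B.R.X) (a : 𝟙_ V ⟶ B.A.X) :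
    pair a (r ≫ B.s.hom) ≫ MonObj.mul ≫ B.eps = pair (a ≫ B.eps) r ≫ MonObj.mul := by
  rw [← Category.assoc]
  refine congr($((B.pair_actRight (RightModule.regular B.A) r a).symm) ≫ B.eps).trans ?_
  rw [Category.assoc]
  exact pair_actRight_hom B.counit r a

lemma one_eps : MonObj.one ≫ B.eps = MonObj.one := B.one_counit

lemma comp_s_eps (r : 𝟙_ V ⟶ B.R.X) : r ≫ B.s.hom ≫ B.eps = r := by
  have h := B.pair_actRight_eps r MonObj.one
  rwa [← Category.assoc, pair_one_mul, one_eps, pair_one_mul, Category.assoc] at h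

lemma pair_s_eps (a b : 𝟙_ V ⟶ B.A.X) :
    pair (a ≫ B.eps ≫ B.s.hom) b ≫ MonObj.mul ≫ B.eps = pair a b ≫ MonObj.mul ≫ B.eps := by
  have h : (B.eps ≫ B.s.hom) ▷ B.A.X ≫ MonObj.mul ≫ B.eps = MonObj.mul ≫ B.eps := B.s_counit
  rw [← pair_whiskerRight, Category.assoc, h]

lemma pair_t_eps (a b : 𝟙_ V ⟶ B.A.X) :
    pair (a ≫ B.eps ≫ B.t) b ≫ MonObj.mul ≫ B.eps = pair a b ≫ MonObj.mul ≫ B.eps := by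
  have h : (B.eps ≫ B.t) ▷ B.A.X ≫ MonObj.mul ≫ B.eps = MonObj.mul ≫ B.eps := B.t_counit
  rw [← pair_whiskerRight, Category.assoc, h]

/-- Restriction to bimodules takes the tensor product of right `A`-modules to `⊗_R`; the underlying
arrow in `V` is the identity. -/
noncomputable def tensorIso (X Y : RightModule B.A) :
    B.restrictObj X ⊗ B.restrictObj Y ≅ B.restrictObj (B.tensorObj X Y) :=
  Bimod.isoOfIso (Iso.refl _)
    (by
      rw [Iso.refl_hom, Category.comp_id, whiskerLeft_id, Category.id_comp]
      apply whiskerLeft_proj_ext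
      intro r x y
      refine Eq.trans ?_ (B.pair_actLeft (B.tensorObj X Y) r _).symm
      rw [B.pair_tensorAct, Bimod.comp_hom', Category.assoc,
        ← Category.assoc B.t, ← Category.assoc r, B.comp_t_comul, Category.assoc, proj_tensorHom,
        pair_tensorHom_assoc, B.comp_orbit, B.comp_orbit, Y.pair_act_one, pair_proj_actLeft,
        B.pair_actLeft])
    (by
      rw [Iso.refl_hom, Category.comp_id, id_whiskerRight, Category.id_comp]
      apply proj_whiskerRight_ext
      intro x y r
      refine Eq.trans ?_ (B.pair_actRight (B.tensorObj X Y) r _).symm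
      rw [B.pair_tensorAct, Bimod.comp_hom', Category.assoc,
        ← Category.assoc B.s.hom, ← Category.assoc r, B.comp_s_comul, Category.assoc,
        proj_tensorHom, pair_tensorHom_assoc, B.comp_orbit, B.comp_orbit, X.pair_act_one,
        pair_proj_actRight, B.pair_actRight])

lemma comp_orbit_tensorObj {X Y : RightModule B.A} (x : 𝟙_ V ⟶ X.X) (y : 𝟙_ V ⟶ Y.X) :
    B.orbit (X := B.tensorObj X Y) (pair x y ≫ proj (B.restrictObj X) (B.restrictObj Y)) =
      B.comul ≫ (B.orbit x ⊗ₘ B.orbit y) ≫ (B.tensorIso X Y).hom := by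
  apply Bimod.hom_ext
  apply ext_one
  intro a
  rw [B.comp_orbit, B.pair_tensorAct, ← Category.assoc B.comul, Bimod.comp_hom' _ (B.tensorIso X Y).hom]
  exact congr(a ≫ $((Category.comp_id _).symm))

/-- The tensor product of morphisms of right `A`-modules. -/
noncomputable abbrev tensorHom {X Y X' Y' : RightModule B.A} (f : X ⟶ X') (g : Y ⟶ Y') :
    B.tensorObj X Y ⟶ B.tensorObj X' Y' :=
  ⟨(B.restrictMap f ⊗ₘ B.restrictMap g).hom, B.comp_tensorAct X Y f g⟩

/-- The unit right `A`-module: the object `R` with the action `r · a = ε(s(r) a)`. -/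
noncomputable abbrev tensorUnit : RightModule B.A :=
  RightModule.ofElements B.R.X (B.s.hom ▷ B.A.X ≫ MonObj.mul ≫ B.eps)
    (by
      intro r
      rw [pair_whiskerRight_assoc, ← Category.assoc, pair_mul_one, Category.assoc,
        B.comp_s_eps])
    (by
      intro r a b
      rw [pair_whiskerRight_assoc, pair_whiskerRight_assoc, pair_whiskerRight_assoc,
        Category.assoc, Category.assoc, ← Category.assoc (pair (r ≫ B.s.hom) a), B.pair_s_eps,
        ← Category.assoc, pair_mul_assoc, Category.assoc])

lemma pair_tensorUnit (r : 𝟙_ V ⟶ B.R.X) (a : 𝟙_ V ⟶ B.A.X) :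
    pair r a ≫ B.tensorUnit.act = pair (r ≫ B.s.hom) a ≫ MonObj.mul ≫ B.eps :=
  pair_whiskerRight_assoc _ _ _ _

lemma pair_restrict_tensorUnit_actLeft (r r' : 𝟙_ V ⟶ B.R.X) :
    pair r r' ≫ (B.restrictObj B.tensorUnit).actLeft = pair r r' ≫ MonObj.mul := by
  refine (B.pair_actLeft B.tensorUnit r r').trans ?_
  rw [pair_tensorUnit, pair_actLeft_eps, Category.assoc, comp_s_eps]

lemma pair_restrict_tensorUnit_actRight (r r' : 𝟙_ V ⟶ B.R.X) :
    pair r' r ≫ (B.restrictObj B.tensorUnit).actRight = pair r' r ≫ MonObj.mul := by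
  refine (B.pair_actRight B.tensorUnit r r').trans ?_
  rw [pair_tensorUnit, pair_actRight_eps, Category.assoc, comp_s_eps]

/-- Restriction to bimodules takes the unit module to the regular bimodule `R`; the underlying
arrow in `V` is the identity. -/
noncomputable def unitIso : 𝟙_ (Bimod B.R B.R) ≅ B.restrictObj B.tensorUnit :=
  Bimod.isoOfIso (P := Bimod.regular B.R) (Iso.refl B.R.X)
    (by
      have h : (B.restrictObj B.tensorUnit).actLeft = MonObj.mul (X := B.R.X) :=
        ext_pair fun r r' => B.pair_restrict_tensorUnit_actLeft r r'
      have h' : MonObj.mul (X := B.R.X) ≫ 𝟙 B.R.X =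
          B.R.X ◁ 𝟙 B.R.X ≫ (B.restrictObj B.tensorUnit).actLeft := by
        rw [h]; simp
      exact h')
    (by
      have h : (B.restrictObj B.tensorUnit).actRight = MonObj.mul (X := B.R.X) :=
        ext_pair fun r r' => B.pair_restrict_tensorUnit_actRight r' r
      have h' : MonObj.mul (X := B.R.X) ≫ 𝟙 B.R.X =
          𝟙 B.R.X ▷ B.R.X ≫ (B.restrictObj B.tensorUnit).actRight := by
        rw [h]; simp
      exact h')

lemma orbit_unitIso_inv (r : 𝟙_ V ⟶ B.R.X) :
    B.orbit (X := B.tensorUnit) r ≫ B.unitIso.inv = B.mulLeft (r ≫ B.s.hom) ≫ B.counit := by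
  apply Bimod.hom_ext
  apply ext_one
  intro a
  refine Eq.trans (Eq.trans congr(a ≫ $(Category.comp_id _)) (B.comp_orbit (X := B.tensorUnit) r a))
    ((B.pair_tensorUnit r a).trans ?_)
  refine Eq.trans ?_ congr($((RightModule.comp_orbit (X := RightModule.regular B.A)
    (r ≫ B.s.hom) a).symm) ≫ B.eps) |>.trans (Category.assoc _ _ _)
  exact (Category.assoc _ _ _).symm

lemma orbit_unitIso_inv' (r : 𝟙_ V ⟶ B.R.X) :
    B.orbit (X := B.tensorUnit) r ≫ B.unitIso.inv = B.mulLeft (r ≫ B.t) ≫ B.counit := by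
  rw [B.orbit_unitIso_inv]
  apply Bimod.hom_ext
  apply ext_one
  intro a
  have h₁ := RightModule.comp_orbit (X := RightModule.regular B.A) (r ≫ B.s.hom) a
  have h₂ := RightModule.comp_orbit (X := RightModule.regular B.A) (r ≫ B.t) a
  have h := B.pair_t_eps (r ≫ B.s.hom) a
  have e : (r ≫ B.s.hom) ≫ B.eps ≫ B.t = r ≫ B.t := by
    have := congr($(B.comp_s_eps r) ≫ B.t)
    simpa using this
  rw [e] at h
  refine Eq.trans (Category.assoc _ _ _).symm (Eq.trans congr($h₁ ≫ B.eps) ?_)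
  refine Eq.trans ?_ (Eq.trans congr($(h₂.symm) ≫ B.eps) (Category.assoc _ _ _))
  exact (Category.assoc _ _ _).trans (h.symm.trans (Category.assoc _ _ _).symm)

/-- An isomorphism of bimodules that is compatible with the actions of `A` is one of modules. -/
noncomputable def liftIso {P Q : RightModule B.A} (e : B.restrictObj P ≅ B.restrictObj Q)
    (h : P.act ≫ e.hom.hom = e.hom.hom ▷ B.A.X ≫ Q.act) : P ≅ Q :=
  RightModule.isoMk ((Bimod.forget B.R).mapIso e) h


lemma comp_of_orbit {P Q : RightModule B.A} (g : B.restrictObj P ⟶ B.restrictObj Q)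
    {p : 𝟙_ V ⟶ P.X} {q : 𝟙_ V ⟶ Q.X} (h : B.orbit p ≫ g = B.orbit q) : p ≫ g.hom = q := by
  have := congr(MonObj.one ≫ ($h).hom)
  rwa [Bimod.comp_hom', ← Category.assoc, B.comp_orbit, B.comp_orbit, P.pair_act_one,
    Q.pair_act_one] at this

lemma linear_of_orbit {P Q : RightModule B.A} (g : B.restrictObj P ⟶ B.restrictObj Q)
    {p : 𝟙_ V ⟶ P.X} {q : 𝟙_ V ⟶ Q.X} (h : B.orbit p ≫ g = B.orbit q) (a : 𝟙_ V ⟶ B.A.X) :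
    pair p a ≫ P.act ≫ g.hom = pair p a ≫ g.hom ▷ B.A.X ≫ Q.act := by
  rw [pair_whiskerRight_assoc, B.comp_of_orbit g h, ← B.comp_orbit, ← h, Bimod.comp_hom',
    ← Category.assoc, ← Category.assoc, B.comp_orbit]

/-- A bimodule map out of `X ⊗_R Y` is `A`-linear if it is compatible with the orbit maps. -/
lemma linear_tensor {X Y Q : RightModule B.A}
    (g : B.restrictObj (B.tensorObj X Y) ⟶ B.restrictObj Q)
    (h : ∀ x y, ∃ q, B.comul ≫ (B.orbit x ⊗ₘ B.orbit y) ≫ (B.tensorIso X Y).hom ≫ g =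
      B.orbit q) : (B.tensorObj X Y).act ≫ g.hom = g.hom ▷ B.A.X ≫ Q.act := by
  apply proj_whiskerRight_ext
  intro x y a
  obtain ⟨q, hq⟩ := h x y
  refine B.linear_of_orbit g (p := pair x y ≫ proj (B.restrictObj X) (B.restrictObj Y))
    (q := q) ?_ a
  rw [comp_orbit_tensorObj, Category.assoc, Category.assoc, hq]

lemma linear_tensor₃ {X Y Z Q : RightModule B.A}
    (g : B.restrictObj (B.tensorObj (B.tensorObj X Y) Z) ⟶ B.restrictObj Q)
    (h : ∀ x y z, ∃ q, B.comul ≫ (B.comul ≫ (B.orbit x ⊗ₘ B.orbit y) ≫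
      (B.tensorIso X Y).hom ⊗ₘ B.orbit z) ≫ (B.tensorIso _ Z).hom ≫ g = B.orbit q) :
    (B.tensorObj (B.tensorObj X Y) Z).act ≫ g.hom = g.hom ▷ B.A.X ≫ Q.act := by
  apply proj_ext₃ (P := B.restrictObj (B.tensorObj X Y)) (L := B.restrictObj Z)
    (proj (B.restrictObj X) (B.restrictObj Y))
  intro x y z a
  obtain ⟨q, hq⟩ := h x y z
  refine B.linear_of_orbit g (q := q) ?_ a
  have e₁ := B.comp_orbit_tensorObj (X := B.tensorObj X Y) (Y := Z)
    (pair x y ≫ proj (B.restrictObj X) (B.restrictObj Y)) z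
  rw [B.comp_orbit_tensorObj x y] at e₁
  refine congr($e₁ ≫ g).trans ?_
  rw [Category.assoc, Category.assoc, hq]

/-- The associativity isomorphism of bimodules is `A`-linear. -/
noncomputable def associator (X Y Z : RightModule B.A) :
    B.tensorObj (B.tensorObj X Y) Z ≅ B.tensorObj X (B.tensorObj Y Z) :=
  B.liftIso
    ((((B.tensorIso _ _).symm ≪≫ ((B.tensorIso _ _).symm ⊗ᵢ .refl _))
        ≪≫ α_ (B.restrictObj X) (B.restrictObj Y) (B.restrictObj Z)
        ≪≫ ((.refl _ ⊗ᵢ B.tensorIso _ _) ≪≫ B.tensorIso _ _)))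
    (by
      apply linear_tensor₃
      intro x y z
      refine ⟨pair x (pair y z ≫ proj (B.restrictObj Y) (B.restrictObj Z)) ≫
        proj (B.restrictObj X) (B.restrictObj (B.tensorObj Y Z)), ?_⟩
      have e := B.comp_orbit_tensorObj (X := X) (Y := B.tensorObj Y Z) x
        (pair y z ≫ proj (B.restrictObj Y) (B.restrictObj Z))
      rw [B.comp_orbit_tensorObj y z] at e
      refine Eq.trans ?_ e.symm
      exact assoc_aux B.coassoc (B.orbit x) (B.orbit y) (B.orbit z) _ _ _ _)

/-- The left unit isomorphism of bimodules is `A`-linear. -/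
noncomputable def leftUnitor (X : RightModule B.A) :
    B.tensorObj B.tensorUnit X ≅ X :=
  B.liftIso (((B.tensorIso _ _).symm ≪≫ (B.unitIso.symm ⊗ᵢ .refl _)) ≪≫ λ_ (B.restrictObj X))
    (by
      apply linear_tensor
      intro r x
      refine ⟨pair x (r ≫ B.t) ≫ X.act, ?_⟩
      rw [← B.mulLeft_orbit]
      exact left_aux B.comul_counit (B.takeuchi r) _ _ _ _ (B.orbit_unitIso_inv r))

/-- The right unit isomorphism of bimodules is `A`-linear. -/
noncomputable def rightUnitor (X : RightModule B.A) :
    B.tensorObj X B.tensorUnit ≅ X :=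
  B.liftIso (((B.tensorIso _ _).symm ≪≫ (.refl _ ⊗ᵢ B.unitIso.symm)) ≪≫ ρ_ (B.restrictObj X))
    (by
      apply linear_tensor
      intro x r
      refine ⟨pair x (r ≫ B.s.hom) ≫ X.act, ?_⟩
      rw [← B.mulLeft_orbit]
      exact right_aux B.counit_comul (B.takeuchi r) _ _ _ _ (B.orbit_unitIso_inv' r))

variable (B : RightBialgebroid V)

/-- The category `V_A` of right modules over (the monoid underlying) a right bialgebroid; its
monoidal structure depends on the whole bialgebroid. -/
def Mod : Type (max u v) := RightModule B.A

instance : Category B.Mod := inferInstanceAs (Category (RightModule B.A))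

noncomputable instance : MonoidalCategoryStruct B.Mod where
  tensorObj X Y := B.tensorObj X Y
  tensorHom f g := B.tensorHom f g
  whiskerLeft X _ _ g := B.tensorHom (𝟙 (X : RightModule B.A)) g
  whiskerRight f Y := B.tensorHom f (𝟙 (Y : RightModule B.A))
  tensorUnit := B.tensorUnit
  associator X Y Z := B.associator X Y Z
  leftUnitor X := B.leftUnitor X
  rightUnitor X := B.rightUnitor X

/-- The forgetful functor `Φ^A` from right `A`-modules to `R`-`R`-bimodules. -/
def toBimod : B.Mod ⥤ Bimod B.R B.R := B.restrict

instance : B.toBimod.Faithful := inferInstanceAs B.restrict.Faithful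

/-- The tensor product of right `A`-modules is that of the underlying bimodules. -/
noncomputable def inducingData : Monoidal.InducingFunctorData B.toBimod where
  μIso X Y := B.tensorIso X Y
  εIso := B.unitIso
  whiskerLeft_eq X _ _ f := by
    rw [← id_tensorHom]
    apply Bimod.hom_ext
    exact ((Category.id_comp _).trans (Category.comp_id _)).symm
  whiskerRight_eq f Y := by
    rw [← tensorHom_id]
    apply Bimod.hom_ext
    exact ((Category.id_comp _).trans (Category.comp_id _)).symm
  tensorHom_eq f g := by
    apply Bimod.hom_ext
    exact ((Category.id_comp _).trans (Category.comp_id _)).symm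
  associator_eq X Y Z := rfl
  leftUnitor_eq X := rfl
  rightUnitor_eq X := rfl

noncomputable instance : MonoidalCategory B.Mod :=
  Monoidal.induced B.toBimod B.inducingData

noncomputable instance : B.toBimod.Monoidal :=
  Monoidal.fromInducedMonoidal B.toBimod B.inducingData

/-- The long forgetful functor `G^A = Γ^R Φ^A` from right `A`-modules to `V`. -/
noncomputable def longForget : B.Mod ⥤ V := B.toBimod ⋙ bimodForget B.R

noncomputable instance : B.longForget.LaxMonoidal :=
  inferInstanceAs (B.toBimod ⋙ bimodForget B.R).LaxMonoidal

end RightBialgebroid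

section TensorDesc
variable {R : Mon V} {M N P Q : Bimod R R}

/-- The arrow `M ⊗_R N ⟶ Z` induced by an `R`-balanced arrow `M ⊗ N ⟶ Z`. -/
noncomputable def projDesc {Z : V} (f : M.X ⊗ N.X ⟶ Z)
    (balanced : M.actRight ▷ N.X ≫ f = (α_ _ _ _).hom ≫ M.X ◁ N.actLeft ≫ f) : (M ⊗ N).X ⟶ Z :=
  coequalizer.desc f (balanced.trans (Category.assoc _ _ _).symm)

lemma proj_projDesc {Z : V} (f : M.X ⊗ N.X ⟶ Z) (balanced) :
    proj M N ≫ projDesc f balanced = f :=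
  coequalizer.π_desc _ _

/-- The bimodule morphism `M ⊗_R N ⟶ P` induced by an `R`-balanced arrow `M ⊗ N ⟶ P` that is
compatible with the outer actions. -/
noncomputable def tensorDesc (f : M.X ⊗ N.X ⟶ P.X)
    (balanced : M.actRight ▷ N.X ≫ f = (α_ _ _ _).hom ≫ M.X ◁ N.actLeft ≫ f)
    (left : M.actLeft ▷ N.X ≫ f = (α_ _ _ _).hom ≫ R.X ◁ f ≫ P.actLeft)
    (right : (α_ _ _ _).hom ≫ M.X ◁ N.actRight ≫ f = f ▷ R.X ≫ P.actRight) : M ⊗ N ⟶ P where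
  hom := projDesc f balanced
  left_act_hom := by
    have : Epi (R.X ◁ proj M N) := inferInstanceAs (Epi ((tensorLeft _).map _))
    rw [← cancel_epi (R.X ◁ proj M N), ← Category.assoc, proj_actLeft, Category.assoc,
      Category.assoc, proj_projDesc, left, Iso.inv_hom_id_assoc, ← Category.assoc,
      ← whiskerLeft_comp, proj_projDesc]
  right_act_hom := by
    have : Epi (proj M N ▷ R.X) := inferInstanceAs (Epi ((tensorRight _).map _))
    rw [← cancel_epi (proj M N ▷ R.X), ← Category.assoc, proj_actRight, Category.assoc,
      Category.assoc, proj_projDesc, right, ← Category.assoc, ← comp_whiskerRight, proj_projDesc]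

lemma proj_tensorDesc (f : M.X ⊗ N.X ⟶ P.X) (balanced left right) :
    proj M N ≫ (tensorDesc f balanced left right).hom = f :=
  coequalizer.π_desc _ _

lemma tensor_hom_ext {f g : M ⊗ N ⟶ P} (h : proj M N ≫ f.hom = proj M N ≫ g.hom) : f = g :=
  Bimod.hom_ext _ _ ((cancel_epi _).1 h)

lemma tensor_hom_ext₃ {f g : (M ⊗ N) ⊗ P ⟶ Q}
    (h : proj M N ▷ P.X ≫ proj (M ⊗ N) P ≫ f.hom = proj M N ▷ P.X ≫ proj (M ⊗ N) P ≫ g.hom) :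
    f = g := by
  have : Epi (proj M N ▷ P.X) := inferInstanceAs (Epi ((tensorRight _).map _))
  exact tensor_hom_ext ((cancel_epi _).1 h)

end TensorDesc

section Canonical
variable {C : Type*} [Category* C] [MonoidalCategory C] (G : C ⥤ V) [G.LaxMonoidal]
open Functor.LaxMonoidal

lemma lax_left (b c : C) : (μ G (𝟙_ C) b ≫ G.map (λ_ b).hom) ▷ G.obj c ≫ μ G b c =
    (α_ _ _ _).hom ≫ G.obj (𝟙_ C) ◁ μ G b c ≫ μ G (𝟙_ C) (b ⊗ c) ≫ G.map (λ_ (b ⊗ c)).hom := by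
  rw [comp_whiskerRight, Category.assoc, μ_natural_left, ← associativity_assoc, ← G.map_comp]
  congr 4
  monoidal

lemma lax_right (b c : C) :
    (α_ _ _ _).hom ≫ G.obj b ◁ (μ G c (𝟙_ C) ≫ G.map (ρ_ c).hom) ≫ μ G b c =
      μ G b c ▷ G.obj (𝟙_ C) ≫ μ G (b ⊗ c) (𝟙_ C) ≫ G.map (ρ_ (b ⊗ c)).hom := by
  rw [whiskerLeft_comp, Category.assoc, μ_natural_right, ← associativity_assoc, ← G.map_comp]
  congr 4
  monoidal

lemma lax_balanced (a b : C) :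
    (μ G a (𝟙_ C) ≫ G.map (ρ_ a).hom) ▷ G.obj b ≫ μ G a b =
      (α_ _ _ _).hom ≫ G.obj a ◁ (μ G (𝟙_ C) b ≫ G.map (λ_ b).hom) ≫ μ G a b := by
  rw [whiskerLeft_comp, comp_whiskerRight, Category.assoc, Category.assoc, μ_natural_left,
    μ_natural_right, ← associativity_assoc, ← G.map_comp]
  congr 4
  monoidal

/-- The base monoid `R = G e`, with unit `G_0` and multiplication `G (l_e) ∘ G_{e,e}`. -/
abbrev baseMon : Mon V := G.mapMon.obj (Mon.trivial C)

lemma baseMon_one : MonObj.one (X := (baseMon G).X) = ε G := by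
  change ε G ≫ G.map (𝟙 _) = _
  simp

lemma baseMon_mul : MonObj.mul (X := (baseMon G).X) = μ G (𝟙_ C) (𝟙_ C) ≫ G.map (λ_ (𝟙_ C)).hom :=
  rfl

/-- The bimodule `U c`: the object `G c` with actions `G (l_c) ∘ G_{e,c}` and
`G (r_c) ∘ G_{c,e}`. -/
abbrev canonicalObj (c : C) : Bimod (baseMon G) (baseMon G) where
  X := G.obj c
  actLeft := μ G (𝟙_ C) c ≫ G.map (λ_ c).hom
  actRight := μ G c (𝟙_ C) ≫ G.map (ρ_ c).hom
  one_actLeft := by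
    rw [baseMon_one]
    exact (left_unitality G c).symm
  actRight_one := by
    rw [baseMon_one]
    exact (right_unitality G c).symm
  left_assoc := by
    have h := congr($(lax_left G (𝟙_ C) c) ≫ G.map (λ_ c).hom)
    simp only [Category.assoc] at h
    refine h.trans ?_
    have h' : (λ_ (𝟙_ C ⊗ c)).hom = 𝟙_ C ◁ (λ_ c).hom := by monoidal
    rw [h', ← μ_natural_right_assoc]
    exact congr(_ ≫ $((whiskerLeft_comp_assoc _ _ _ _).symm))
  right_assoc := by
    have h := congr((α_ _ _ _).inv ≫ $(lax_right G c (𝟙_ C)) ≫ G.map (ρ_ c).hom)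
    simp only [Category.assoc, Iso.inv_hom_id_assoc] at h
    have h' : (ρ_ (c ⊗ 𝟙_ C)).hom = (ρ_ c).hom ▷ 𝟙_ C := by monoidal
    rw [h', ← μ_natural_left_assoc, ← unitors_equal] at h
    refine h.trans ?_
    exact congr(_ ≫ $((comp_whiskerRight_assoc _ _ _ _).symm))
  middle_assoc := by
    have h := congr($(lax_left G c (𝟙_ C)) ≫ G.map (ρ_ c).hom)
    simp only [Category.assoc] at h
    refine h.trans ?_
    rw [← G.map_comp, ← leftUnitor_naturality, G.map_comp, ← μ_natural_right_assoc]
    exact congr(_ ≫ $((whiskerLeft_comp_assoc _ _ _ _).symm))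

/-- The functor `U` in the canonical factorization `G = Γ U`. -/
abbrev canonical : C ⥤ Bimod (baseMon G) (baseMon G) where
  obj c := canonicalObj G c
  map {c d} f :=
    { hom := G.map f
      left_act_hom := by
        change (μ G (𝟙_ C) c ≫ G.map (λ_ c).hom) ≫ G.map f =
          G.obj (𝟙_ C) ◁ G.map f ≫ μ G (𝟙_ C) d ≫ G.map (λ_ d).hom
        rw [μ_natural_right_assoc, Category.assoc, ← G.map_comp, ← G.map_comp,
          leftUnitor_naturality]
      right_act_hom := by
        change (μ G c (𝟙_ C) ≫ G.map (ρ_ c).hom) ≫ G.map f =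
          G.map f ▷ G.obj (𝟙_ C) ≫ μ G d (𝟙_ C) ≫ G.map (ρ_ d).hom
        rw [μ_natural_left_assoc, Category.assoc, ← G.map_comp, ← G.map_comp,
          rightUnitor_naturality] }

/-- The comparison arrow `U_{a,b} : U a ⊗_R U b ⟶ U (a ⊗ b)` induced by `G_{a,b}`. -/
noncomputable def canonicalμ (a b : C) :
    canonicalObj G a ⊗ canonicalObj G b ⟶ canonicalObj G (a ⊗ b) :=
  tensorDesc (μ G a b) (lax_balanced G a b) (lax_left G a b) (lax_right G a b)

lemma proj_canonicalμ (a b : C) :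
    proj (canonicalObj G a) (canonicalObj G b) ≫ (canonicalμ G a b).hom = μ G a b :=
  proj_tensorDesc _ _ _ _

/-- The comparison arrow `U_0 : R ⟶ U e`, which is the identity on underlying objects. -/
noncomputable def canonicalε : 𝟙_ (Bimod (baseMon G) (baseMon G)) ⟶ canonicalObj G (𝟙_ C) where
  hom := 𝟙 (G.obj (𝟙_ C))
  left_act_hom := by
    change (μ G (𝟙_ C) (𝟙_ C) ≫ G.map (λ_ (𝟙_ C)).hom) ≫ 𝟙 (G.obj (𝟙_ C)) =
      G.obj (𝟙_ C) ◁ 𝟙 (G.obj (𝟙_ C)) ≫ μ G (𝟙_ C) (𝟙_ C) ≫ G.map (λ_ (𝟙_ C)).hom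
    simp
  right_act_hom := by
    change (μ G (𝟙_ C) (𝟙_ C) ≫ G.map (λ_ (𝟙_ C)).hom) ≫ 𝟙 (G.obj (𝟙_ C)) =
      𝟙 (G.obj (𝟙_ C)) ▷ G.obj (𝟙_ C) ≫ μ G (𝟙_ C) (𝟙_ C) ≫ G.map (ρ_ (𝟙_ C)).hom
    simp [unitors_equal]

noncomputable instance : (canonical G).LaxMonoidal where
  ε := canonicalε G
  μ := canonicalμ G
  μ_natural_left {a a'} f b := by
    apply tensor_hom_ext
    rw [Bimod.comp_hom', Bimod.comp_hom', ← Category.assoc, ← Category.assoc, proj_whiskerRight,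
      proj_canonicalμ, Category.assoc, proj_canonicalμ]
    exact μ_natural_left G f b
  μ_natural_right {b b'} a f := by
    apply tensor_hom_ext
    rw [Bimod.comp_hom', Bimod.comp_hom', ← Category.assoc, ← Category.assoc, proj_whiskerLeft,
      proj_canonicalμ, Category.assoc, proj_canonicalμ]
    exact μ_natural_right G a f
  associativity a b c := by
    apply tensor_hom_ext₃
    simp only [Bimod.comp_hom']
    have e₁ := proj_whiskerRight (canonicalμ G a b) (canonicalObj G c)
    have e₂ := proj_whiskerLeft (canonicalObj G a) (canonicalμ G b c)
    have e₃ := proj_associator (canonicalObj G a) (canonicalObj G b) (canonicalObj G c)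
    have f₁ := congr($(proj_canonicalμ G a b) ▷ G.obj c)
    have f₂ := congr(G.obj a ◁ $(proj_canonicalμ G b c))
    have g₁ := proj_canonicalμ G (a ⊗ b) c
    have g₂ := proj_canonicalμ G a (b ⊗ c)
    rw [comp_whiskerRight] at f₁
    rw [whiskerLeft_comp] at f₂
    rw [reassoc_of% e₁, reassoc_of% e₃, reassoc_of% e₂, reassoc_of% g₁, g₂]
    have h := associativity G a b c
    rw [← f₁, ← f₂] at h
    simp only [Category.assoc] at h
    exact h
  left_unitality a := by
    apply tensor_hom_ext
    refine (proj_leftUnitor (canonicalObj G a)).trans ?_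
    have e₁ := proj_whiskerRight (canonicalε G) (canonicalObj G a)
    have e₂ := proj_canonicalμ G (𝟙_ C) a
    simp only [Bimod.comp_hom']
    have h : μ G (𝟙_ C) a ≫ G.map (λ_ a).hom = _ := congr($(e₂.symm) ≫ G.map (λ_ a).hom)
    rw [Category.assoc] at h
    refine h.trans ?_
    refine Eq.trans ?_ ((Category.assoc _ _ _).symm.trans
      (congr($e₁ ≫ _).trans (Category.assoc _ _ _))).symm
    exact (id_whiskerRight_assoc _ _ _).symm
  right_unitality a := by
    apply tensor_hom_ext
    refine (proj_rightUnitor (canonicalObj G a)).trans ?_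
    have e₁ := proj_whiskerLeft (canonicalObj G a) (canonicalε G)
    have e₂ := proj_canonicalμ G a (𝟙_ C)
    simp only [Bimod.comp_hom']
    have h : μ G a (𝟙_ C) ≫ G.map (ρ_ a).hom = _ := congr($(e₂.symm) ≫ G.map (ρ_ a).hom)
    rw [Category.assoc] at h
    refine h.trans ?_
    refine Eq.trans ?_ ((Category.assoc _ _ _).symm.trans
      (congr($e₁ ≫ _).trans (Category.assoc _ _ _))).symm
    exact (whiskerLeft_id_assoc _ _ _).symm

/-- `G` is essentially strong monoidal: the functor `U` in its canonical factorization
`G = Γ U` through the `R`-`R`-bimodules, `R = G e`, is strong monoidal. -/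
def EssentiallyStrong : Prop :=
  IsIso (ε (canonical G)) ∧ ∀ a b : C, IsIso (μ (canonical G) a b)

end Canonical

section Linear
variable [Preadditive V] [MonoidalPreadditive V] {A : Mon V}

namespace RightModule
variable {X Y Z : RightModule A}

instance : Zero (X ⟶ Y) := ⟨⟨0, by simp⟩⟩
instance : Add (X ⟶ Y) := ⟨fun f g => ⟨f.hom + g.hom, by simp [f.act_hom, g.act_hom]⟩⟩
instance : Neg (X ⟶ Y) := ⟨fun f => ⟨-f.hom, by
  have h : (-f.hom) ▷ A.X = -(f.hom ▷ A.X) := (tensorRight A.X).map_neg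
  simp [f.act_hom, h]⟩⟩
instance : Sub (X ⟶ Y) := ⟨fun f g => ⟨f.hom - g.hom, by
  have h : (f.hom - g.hom) ▷ A.X = f.hom ▷ A.X - g.hom ▷ A.X := (tensorRight A.X).map_sub
  simp [f.act_hom, g.act_hom, h]⟩⟩
instance : SMul ℕ (X ⟶ Y) := ⟨fun n f => ⟨n • f.hom, by
  have h : (n • f.hom) ▷ A.X = n • f.hom ▷ A.X := (tensorRight A.X).map_nsmul
  simp [f.act_hom, h]⟩⟩
instance : SMul ℤ (X ⟶ Y) := ⟨fun n f => ⟨n • f.hom, by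
  have h : (n • f.hom) ▷ A.X = n • f.hom ▷ A.X := (tensorRight A.X).map_zsmul
  simp [f.act_hom, h]⟩⟩

instance : AddCommGroup (X ⟶ Y) :=
  Function.Injective.addCommGroup (fun f : X ⟶ Y => f.hom) (fun _ _ h => hom_ext h) rfl
    (fun _ _ => rfl) (fun _ => rfl) (fun _ _ => rfl) (fun _ _ => rfl) (fun _ _ => rfl)

instance : Preadditive (RightModule A) where
  add_comp X Y Z f f' g := hom_ext (Preadditive.add_comp _ _ _ f.hom f'.hom g.hom)
  comp_add X Y Z f g g' := hom_ext (Preadditive.comp_add _ _ _ f.hom g.hom g'.hom)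

variable (k : Type*) [CommRing k] [Linear k V] [MonoidalLinear k V]

instance : SMul k (X ⟶ Y) := ⟨fun r f => ⟨r • f.hom, by simp [f.act_hom]⟩⟩

/-- The additive map underlying the forgetful functor on morphisms. -/
def homAddHom : (X ⟶ Y) →+ (X.X ⟶ Y.X) where
  toFun f := f.hom
  map_zero' := rfl
  map_add' _ _ := rfl

instance : Module k (X ⟶ Y) :=
  Function.Injective.module k (homAddHom (X := X) (Y := Y)) (fun _ _ h => hom_ext h)
    (fun _ _ => rfl)

instance : Linear k (RightModule A) where
  smul_comp X Y Z r f g := hom_ext (Linear.smul_comp _ _ _ r f.hom g.hom)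
  comp_smul X Y Z f r g := hom_ext (Linear.comp_smul _ _ _ f.hom r g.hom)

end RightModule

instance (B : RightBialgebroid V) : Preadditive B.Mod :=
  inferInstanceAs (Preadditive (RightModule B.A))

instance (B : RightBialgebroid V) (k : Type*) [CommRing k] [Linear k V] [MonoidalLinear k V] :
    Linear k B.Mod :=
  inferInstanceAs (Linear k (RightModule B.A))

instance (B : RightBialgebroid V) : B.longForget.Additive where
  map_add := rfl

instance (B : RightBialgebroid V) (k : Type*) [CommRing k] [Linear k V] [MonoidalLinear k V] :
    B.longForget.Linear k where
  map_smul _ _ := rfl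

end Linear


end Base

section Over
variable {C D V : Type*} [Category* C] [Category* D] [Category* V]

/-- An equivalence between `G` and `H` in the 2-category of categories over `V`, whose 1-cells
`G ⟶ H` are functors `K` together with an isomorphism `K ⋙ H ≅ G`, and whose 2-cells are the
natural transformations that are compatible with these isomorphisms. -/
structure EquivalenceOver (G : C ⥤ V) (H : D ⥤ V) where
  functor : C ⥤ D
  functorIso : functor ⋙ H ≅ G
  inverse : D ⥤ C
  inverseIso : inverse ⋙ G ≅ H
  unitIso : 𝟭 C ≅ functor ⋙ inverse
  counitIso : inverse ⋙ functor ≅ 𝟭 D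
  unit_over (c : C) : G.map (unitIso.hom.app c) ≫ inverseIso.hom.app (functor.obj c) ≫
    functorIso.hom.app c = 𝟙 (G.obj c)
  counit_over (d : D) : H.map (counitIso.hom.app d) =
    functorIso.hom.app (inverse.obj d) ≫ inverseIso.hom.app d

namespace EquivalenceOver
variable {G : C ⥤ V} {H : D ⥤ V}

/-- The equivalence consists of `k`-linear functors. -/
structure IsLinear (k : Type*) [CommRing k] [Preadditive C] [Preadditive D]
    [Linear k C] [Linear k D] (E : EquivalenceOver G H) : Prop where
  functor_additive : E.functor.Additive
  functor_linear : E.functor.Linear k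
  inverse_additive : E.inverse.Additive
  inverse_linear : E.inverse.Linear k

/-- A strong monoidal structure on an equivalence over `V`, such that all the natural
isomorphisms involved are monoidal. -/
structure MonoidalStructure [MonoidalCategory C] [MonoidalCategory D] [MonoidalCategory V]
    [G.LaxMonoidal] [H.LaxMonoidal] (E : EquivalenceOver G H) where
  functor : E.functor.Monoidal
  inverse : E.inverse.Monoidal
  functorIso : NatTrans.IsMonoidal E.functorIso.hom
  inverseIso : NatTrans.IsMonoidal E.inverseIso.hom
  unitIso : NatTrans.IsMonoidal E.unitIso.hom
  counitIso : NatTrans.IsMonoidal E.counitIso.hom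

end EquivalenceOver

end Over

end LongForgetful

open LongForgetful

/-!
Both base categories are symmetric closed monoidal with coequalizers, and their unit is a
generator, so most of the proof is carried out in such a `V`, where equations are checked on
elements `𝟙_ V ⟶ X`.

Reconstruction. Let `G` be monadic with left adjoint `F`, and let `P = F (𝟙_ V)`, so that `G` is
represented by `P`. Composition makes `G P` a monoid acting on every `G c`. If `G` has a right
adjoint as well, then `X ↦ X ⊗ G P` and `X ↦ G F X` are left adjoint functors that agree at the
unit, hence are isomorphic (`RepresentingAction.isIso_strength`). Therefore the algebras of the
monad `G F` are the right modules over `G P`, and `c ↦ G c` is an equivalence from `C` to these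
modules (`RepresentingAction.isEquivalence_comparison`).

A lax monoidal structure on `G` makes `P` a comonoid in `C`: its comultiplication `P ⟶ P ⊗ P` and
its counit `P ⟶ e` classify the elements `G_{P,P} (η ⊗ η)` and `G_0`, where `η` is the universal
element of `G P` (`representingComon`). The two actions of `R = G e` on `η` define the source and
target maps `R ⟶ G P`, and the bimodule structure on `G c` that they induce is the canonical one
(`RepresentingAction.canonicalIso`). If `G` is essentially strong monoidal, then `c ↦ G c` is a
strong monoidal functor to `R`-`R`-bimodules, so it carries the comonoid `P` to a comonoid of
bimodules, and `G P` becomes a bialgebroid (`RepresentingAction.bialgebroid`). All its axioms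
follow from the universal property of `η`. The diagonal action of `G P` on `G c ⊗_R G d`
corresponds to its action on `G (c ⊗ d)` (`RepresentingAction.tensorAct_μ_toBimod`), which is to
say that the equivalence with the modules over the bialgebroid is strong monoidal.

Converse. The functor from right modules to `V` has the left adjoint `X ↦ X ⊗ A` and the right
adjoint `Y ↦ [A, Y]`, it reflects isomorphisms, and right modules have coequalizers; all this
passes to functors equivalent to it, and the crude monadicity theorem applies. The monoidal
structure is transported along the equivalence. Essential strength is preserved because it amounts
to a universal property of the arrows `G a ⊗ G b ⟶ G (a ⊗ b)` (`UniversalTensors`), namely that of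
a tensor product over `R`. In the linear case, `G` is faithful and these arrows are epimorphisms,
hence the transported monoidal product is bilinear.
-/

namespace LongForgetful

/-! ### Elements of right adjoint functors -/

section Hat
variable {V : Type u} [Category.{v} V] [MonoidalCategory V]
variable {C : Type*} [Category* C] {G : C ⥤ V} {F : V ⥤ C} (adj : F ⊣ G)

/-- The universal element of `G`: the unit of the adjunction at the monoidal unit, an element of
`G P` for the representing object `P = F (𝟙_ V)`. -/
def universalElement : 𝟙_ V ⟶ G.obj (F.obj (𝟙_ V)) := adj.unit.app (𝟙_ V)

/-- The morphism `P ⟶ c` classifying an element of `G c`. -/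
def hat {c : C} (x : 𝟙_ V ⟶ G.obj c) : F.obj (𝟙_ V) ⟶ c := (adj.homEquiv _ _).symm x

lemma universalElement_hat {c : C} (x : 𝟙_ V ⟶ G.obj c) :
    universalElement adj ≫ G.map (hat adj x) = x :=
  (adj.homEquiv_unit ..).symm.trans ((adj.homEquiv _ _).apply_symm_apply x)

lemma hat_universalElement_comp {c : C} (f : F.obj (𝟙_ V) ⟶ c) :
    hat adj (universalElement adj ≫ G.map f) = f :=
  (congrArg _ (adj.homEquiv_unit ..).symm).trans ((adj.homEquiv _ _).symm_apply_apply f)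

lemma hat_universalElement : hat adj (universalElement adj) = 𝟙 _ := by
  simpa using hat_universalElement_comp adj (𝟙 _)

lemma hom_ext_universalElement {c : C} {f g : F.obj (𝟙_ V) ⟶ c}
    (h : universalElement adj ≫ G.map f = universalElement adj ≫ G.map g) : f = g := by
  rw [← hat_universalElement_comp adj f, h, hat_universalElement_comp]

lemma hat_comp {c d : C} (x : 𝟙_ V ⟶ G.obj c) (f : c ⟶ d) :
    hat adj x ≫ f = hat adj (x ≫ G.map f) := by
  apply hom_ext_universalElement adj
  rw [universalElement_hat, G.map_comp, ← Category.assoc, universalElement_hat]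

lemma hat_comp_unit {X : V} (x : 𝟙_ V ⟶ X) : hat adj (x ≫ adj.unit.app X) = F.map x := by
  apply hom_ext_universalElement adj
  rw [universalElement_hat]
  exact adj.unit.naturality x

lemma map_comp_counit {c : C} (x : 𝟙_ V ⟶ G.obj c) : F.map x ≫ adj.counit.app c = hat adj x :=
  (adj.homEquiv_counit ..).symm

end Hat

section Action
variable {V : Type u} [Category.{v} V] [MonoidalCategory V] [SymmetricCategory V]
  [MonoidalClosed V] [UnitGenerator V] [HasCoequalizers V]
variable {C : Type*} [Category* C] {G : C ⥤ V} {F : V ⥤ C}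

/-- A right action of `G P` on the objects `G c`, where `P = F (𝟙_ V)`: in terms of
elements, the morphism `P ⟶ c` that classifies `x` acts on `a` through `G`. It expresses that the
representation of `G` by `P` is enriched in `V`. -/
structure RepresentingAction (adj : F ⊣ G) where
  act (c : C) : G.obj c ⊗ G.obj (F.obj (𝟙_ V)) ⟶ G.obj c
  pair_act {c : C} (x : 𝟙_ V ⟶ G.obj c) (a : 𝟙_ V ⟶ G.obj (F.obj (𝟙_ V))) :
    pair x a ≫ act c = a ≫ G.map (hat adj x)

namespace RepresentingAction
variable {adj : F ⊣ G} (S : RepresentingAction adj)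

lemma pair_act_assoc {c : C} (x : 𝟙_ V ⟶ G.obj c) (a : 𝟙_ V ⟶ G.obj (F.obj (𝟙_ V))) {Z : V}
    (h : G.obj c ⟶ Z) : pair x a ≫ S.act c ≫ h = a ≫ G.map (hat adj x) ≫ h := by
  rw [← Category.assoc, pair_act, Category.assoc]

lemma act_naturality {c d : C} (f : c ⟶ d) : S.act c ≫ G.map f = G.map f ▷ _ ≫ S.act d := by
  apply ext_pair
  intro x a
  rw [pair_act_assoc, pair_whiskerRight_assoc, pair_act, ← hat_comp, G.map_comp]

lemma pair_act_act {c : C} (x : 𝟙_ V ⟶ G.obj c) (a b : 𝟙_ V ⟶ G.obj (F.obj (𝟙_ V))) :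
    pair (pair x a ≫ S.act c) b ≫ S.act c = pair x (pair a b ≫ S.act _) ≫ S.act c := by
  simp only [pair_act]
  rw [← hat_comp, G.map_comp, Category.assoc]

lemma pair_act_universalElement {c : C} (x : 𝟙_ V ⟶ G.obj c) :
    pair x (universalElement adj) ≫ S.act c = x := by
  rw [pair_act, universalElement_hat]

/-- The monoid `G P`; in terms of elements, it is the monoid of endomorphisms of `P`. -/
abbrev mon : Mon V where
  X := G.obj (F.obj (𝟙_ V))
  mon :=
    { one := universalElement adj
      mul := S.act _
      one_mul := by
        rw [← cancel_epi (λ_ _).inv]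
        apply ext_one
        intro a
        rw [← Category.assoc, comp_leftUnitor_inv, pair_whiskerRight_assoc, Category.id_comp,
          pair_act, hat_universalElement]
        simp
      mul_one := by
        rw [← cancel_epi (ρ_ _).inv]
        apply ext_one
        intro a
        rw [← Category.assoc, comp_rightUnitor_inv, pair_whiskerLeft_assoc, Category.id_comp,
          pair_act_universalElement]
        simp
      mul_assoc := by
        apply ext_pair₃'
        intro a b c
        rw [pair_whiskerRight_assoc, pair_associator_assoc, pair_whiskerLeft_assoc,
          pair_act_act] }

/-- The comparison functor `c ↦ G c` to the right modules over `G P`. -/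
abbrev comparison : C ⥤ RightModule S.mon where
  obj c := RightModule.ofElements (G.obj c) (S.act c) S.pair_act_universalElement S.pair_act_act
  map f := ⟨G.map f, S.act_naturality f⟩

lemma comp_orbit {c : C} (x : 𝟙_ V ⟶ G.obj c) :
    RightModule.orbit (X := S.comparison.obj c) x = S.comparison.map (hat adj x) := by
  apply RightModule.hom_ext
  apply ext_one
  intro a
  exact (RightModule.comp_orbit (X := S.comparison.obj c) x a).trans (S.pair_act x a)

/-- The arrow `X ⊗ G P ⟶ G F X`, `x ⊗ a ↦ G (F x) a`. -/
def strength (X : V) : X ⊗ G.obj (F.obj (𝟙_ V)) ⟶ G.obj (F.obj X) :=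
  adj.unit.app X ▷ _ ≫ S.act (F.obj X)

lemma pair_strength {X : V} (x : 𝟙_ V ⟶ X) (a : 𝟙_ V ⟶ G.obj (F.obj (𝟙_ V))) :
    pair x a ≫ S.strength X = a ≫ G.map (F.map x) := by
  refine (pair_whiskerRight_assoc _ _ _ _).trans ((S.pair_act _ _).trans ?_)
  exact congr(a ≫ G.map $(hat_comp_unit adj x))

lemma pair_strength_assoc {X Z : V} (x : 𝟙_ V ⟶ X) (a : 𝟙_ V ⟶ G.obj (F.obj (𝟙_ V)))
    (h : G.obj (F.obj X) ⟶ Z) : pair x a ≫ S.strength X ≫ h = a ≫ G.map (F.map x) ≫ h := by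
  rw [← Category.assoc, pair_strength, Category.assoc]

lemma strength_naturality {X Y : V} (f : X ⟶ Y) :
    f ▷ _ ≫ S.strength Y = S.strength X ≫ G.map (F.map f) := by
  apply ext_pair
  intro x a
  rw [pair_whiskerRight_assoc, pair_strength, pair_strength_assoc, F.map_comp, G.map_comp]

lemma strength_counit (c : C) :
    S.strength (G.obj c) ≫ G.map (adj.counit.app c) = S.act c := by
  apply ext_pair
  intro x a
  rw [pair_strength_assoc, ← G.map_comp, map_comp_counit, pair_act]

end RepresentingAction

/-- In a balanced category the elements detect isomorphisms. -/
lemma isIso_of_bijective_elements [Balanced V] {X Y : V} (f : X ⟶ Y)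
    (h : Function.Bijective fun x : 𝟙_ V ⟶ X => x ≫ f) : IsIso f := by
  have : Mono f := ⟨fun g g' e => ext_one fun z => h.1 (by simp [e])⟩
  have : Epi f := ⟨fun g g' e => ext_one fun y => by
    obtain ⟨x, rfl⟩ := h.2 y
    simp [e]⟩
  exact isIso_of_mono_of_epi f

/-- A natural transformation between left adjoint functors on `V` is invertible as soon as it is
so at the unit: its mate is then bijective on elements. -/
lemma isIso_of_isIso_app_unit [Balanced V] {D : Type*} [Category* D] {L₁ L₂ : V ⥤ D}
    {R₁ R₂ : D ⥤ V} (adj₁ : L₁ ⊣ R₁) (adj₂ : L₂ ⊣ R₂) (τ : L₂ ⟶ L₁) [IsIso (τ.app (𝟙_ V))] :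
    IsIso τ := by
  have : ∀ d, IsIso ((conjugateEquiv adj₁ adj₂ τ).app d) := by
    intro d
    apply isIso_of_bijective_elements
    have e : (fun x : 𝟙_ V ⟶ R₁.obj d => x ≫ (conjugateEquiv adj₁ adj₂ τ).app d) =
        ((adj₁.homEquiv _ _).symm.trans
          (((asIso (τ.app (𝟙_ V))).homFromEquiv).symm.trans (adj₂.homEquiv _ _))) := by
      funext x
      obtain ⟨y, rfl⟩ := (adj₁.homEquiv _ _).surjective x
      have h := unit_conjugateEquiv adj₁ adj₂ τ (𝟙_ V)
      change _ = adj₂.homEquiv _ _ (τ.app _ ≫ (adj₁.homEquiv _ _).symm (adj₁.homEquiv _ _ y))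
      rw [Equiv.symm_apply_apply, Adjunction.homEquiv_unit, Adjunction.homEquiv_unit,
        Category.assoc, (conjugateEquiv adj₁ adj₂ τ).naturality, reassoc_of% h, R₂.map_comp]
    rw [e]
    exact Equiv.bijective _
  have := NatIso.isIso_of_isIso_app (conjugateEquiv adj₁ adj₂ τ)
  exact conjugateEquiv_of_iso adj₁ adj₂ τ

namespace RepresentingAction
variable {adj : F ⊣ G} (S : RepresentingAction adj)

/-- If `G` has a right adjoint, then `X ↦ X ⊗ G P` and `X ↦ G F X` are both left adjoints, and they
agree at the unit. -/
lemma isIso_strength [Balanced V] [G.IsLeftAdjoint] (X : V) : IsIso (S.strength X) := by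
  let τ : tensorRight (G.obj (F.obj (𝟙_ V))) ⟶ F ⋙ G :=
    { app := S.strength, naturality := fun _ _ f => S.strength_naturality f }
  have h : τ.app (𝟙_ V) = (λ_ _).hom := by
    rw [← cancel_epi (λ_ _).inv]
    apply ext_one
    intro a
    rw [← Category.assoc, comp_leftUnitor_inv, Iso.inv_hom_id]
    exact (S.pair_strength _ _).trans (by simp)
  have : IsIso (τ.app (𝟙_ V)) := by rw [h]; infer_instance
  have := isIso_of_isIso_app_unit (adj.comp (Adjunction.ofIsLeftAdjoint G))
    ((ihom.adjunction _).ofNatIsoLeft (BraidedCategory.tensorLeftIsoTensorRight _)) τ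
  exact NatIso.isIso_app_of_isIso τ X

variable [Balanced V] [G.IsLeftAdjoint]

/-- The inverse of the strength. -/
noncomputable def costrength (X : V) : G.obj (F.obj X) ⟶ X ⊗ G.obj (F.obj (𝟙_ V)) :=
  have := S.isIso_strength X
  inv (S.strength X)

lemma strength_costrength (X : V) : S.strength X ≫ S.costrength X = 𝟙 _ :=
  have := S.isIso_strength X
  IsIso.hom_inv_id _

lemma comp_costrength_act {M : RightModule S.mon} (x : 𝟙_ V ⟶ M.X)
    (a : 𝟙_ V ⟶ G.obj (F.obj (𝟙_ V))) :
    a ≫ G.map (F.map x) ≫ S.costrength M.X ≫ M.act = pair x a ≫ M.act := by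
  rw [← S.pair_strength_assoc, reassoc_of% S.strength_costrength]

/-- The algebra of the monad `G F` given by a right module `M` over `G P`: its structure map is the
action after the identification `G F M ≅ M ⊗ G P`. -/
noncomputable def toAlgebra (M : RightModule S.mon) : adj.toMonad.Algebra where
  A := M.X
  a := S.costrength M.X ≫ M.act
  unit := by
    apply ext_one
    intro x
    have h : x ≫ adj.unit.app M.X = universalElement adj ≫ G.map (F.map x) :=
      adj.unit.naturality x
    change x ≫ adj.unit.app M.X ≫ S.costrength M.X ≫ M.act = _
    rw [reassoc_of% h, comp_costrength_act]
    exact (M.pair_act_one x).trans (Category.comp_id x).symm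
  assoc := by
    change G.map (adj.counit.app (F.obj M.X)) ≫ S.costrength M.X ≫ M.act =
      G.map (F.map (S.costrength M.X ≫ M.act)) ≫ S.costrength M.X ≫ M.act
    have := S.isIso_strength
    rw [← cancel_epi (S.strength (G.obj (F.obj M.X))), ← cancel_epi (S.strength M.X ▷ _)]
    apply ext_pair₃'
    intro x a b
    rw [pair_whiskerRight_assoc, pair_whiskerRight_assoc, pair_strength,
      ← Category.assoc (S.strength _), S.strength_counit, S.pair_act_assoc, ← hat_comp,
      S.pair_strength_assoc, ← G.map_comp_assoc,
      ← F.map_comp, Category.assoc a, comp_costrength_act, comp_costrength_act, G.map_comp,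
      Category.assoc, ← S.pair_act_assoc, ← Category.assoc, comp_costrength_act,
      RightModule.pair_act_mul]
    rfl

variable {S} in
/-- A linear map between modules in the image of the comparison functor is one of algebras. -/
def algebraHom {c d : C} (g : S.comparison.obj c ⟶ S.comparison.obj d) :
    (Monad.comparison adj).obj c ⟶ (Monad.comparison adj).obj d where
  f := g.hom
  h := by
    have := S.isIso_strength (G.obj c)
    change G.map (F.map g.hom) ≫ G.map (adj.counit.app d) = G.map (adj.counit.app c) ≫ g.hom
    rw [← cancel_epi (S.strength (G.obj c)), ← reassoc_of% S.strength_naturality g.hom,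
      S.strength_counit, ← Category.assoc, S.strength_counit]
    exact g.act_hom.symm

/-- If `G` is monadic and has a right adjoint, then the comparison with the right modules over `G P`
is an equivalence, for the algebras of `G F` are these modules. -/
lemma isEquivalence_comparison [(Monad.comparison adj).IsEquivalence] :
    S.comparison.IsEquivalence where
  faithful := ⟨fun {c d} f g h => (Monad.comparison adj).map_injective <| by
    ext
    exact congr(($h).hom)⟩
  full := ⟨fun {c d} g => ⟨(Monad.comparison adj).preimage (algebraHom g), by
    ext
    exact congr(($((Monad.comparison adj).map_preimage (algebraHom g))).f)⟩⟩
  essSurj := ⟨fun M => by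
    obtain ⟨c, ⟨i⟩⟩ := Functor.EssSurj.mem_essImage (F := Monad.comparison adj) (S.toAlgebra M)
    let f : G.obj c ≅ M.X := adj.toMonad.forget.mapIso i
    have h : G.map (F.map f.hom) ≫ S.costrength M.X ≫ M.act =
      G.map (adj.counit.app _) ≫ f.hom := i.hom.h
    refine ⟨_, ⟨RightModule.isoMk f ?_⟩⟩
    have h' := congr(S.strength _ ≫ $h)
    rw [← reassoc_of% S.strength_naturality, reassoc_of% S.strength_costrength,
      ← Category.assoc (S.strength _), S.strength_counit] at h'
    exact h'.symm⟩

end RepresentingAction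

end Action

/-! ### Bimodule axioms on elements -/

section BimodElements
variable {V : Type u} [Category.{v} V] [MonoidalCategory V] {R : Mon V} (M : Bimod R R)

lemma pair_one_actLeft (x : 𝟙_ V ⟶ M.X) : pair MonObj.one x ≫ M.actLeft = x := by
  have h := congr(x ≫ (λ_ _).inv ≫ $(M.one_actLeft))
  rw [← Category.assoc, comp_leftUnitor_inv, pair_whiskerRight_assoc] at h
  simpa using h

lemma pair_actRight_one (x : 𝟙_ V ⟶ M.X) : pair x MonObj.one ≫ M.actRight = x := by
  have h := congr(x ≫ (ρ_ _).inv ≫ $(M.actRight_one))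
  rw [← Category.assoc, comp_rightUnitor_inv, pair_whiskerLeft_assoc] at h
  simpa using h

lemma pair_mul_actLeft (r r' : 𝟙_ V ⟶ R.X) (x : 𝟙_ V ⟶ M.X) :
    pair (pair r r' ≫ MonObj.mul) x ≫ M.actLeft =
      pair r (pair r' x ≫ M.actLeft) ≫ M.actLeft := by
  have h := congr(pair (pair r r') x ≫ $(M.left_assoc))
  rwa [pair_whiskerRight_assoc, pair_associator_assoc, pair_whiskerLeft_assoc] at h

lemma pair_actRight_mul (x : 𝟙_ V ⟶ M.X) (r r' : 𝟙_ V ⟶ R.X) :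
    pair x (pair r r' ≫ MonObj.mul) ≫ M.actRight =
      pair (pair x r ≫ M.actRight) r' ≫ M.actRight := by
  have h := congr(pair x (pair r r') ≫ $(M.right_assoc))
  rwa [pair_whiskerLeft_assoc, pair_associator_inv_assoc, pair_whiskerRight_assoc] at h

lemma pair_actLeft_actRight (r : 𝟙_ V ⟶ R.X) (x : 𝟙_ V ⟶ M.X) (r' : 𝟙_ V ⟶ R.X) :
    pair (pair r x ≫ M.actLeft) r' ≫ M.actRight =
      pair r (pair x r' ≫ M.actRight) ≫ M.actLeft := by
  have h := congr(pair (pair r x) r' ≫ $(M.middle_assoc))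
  rwa [pair_whiskerRight_assoc, pair_associator_assoc, pair_whiskerLeft_assoc] at h

end BimodElements

/-! ### The comonoid representing a monoidal functor -/

section Comonoid
variable {V : Type u} [Category.{v} V] [MonoidalCategory V]
variable {C : Type*} [Category* C] [MonoidalCategory C] {G : C ⥤ V} [G.LaxMonoidal]
  {F : V ⥤ C} (adj : F ⊣ G)
open Functor.LaxMonoidal

lemma pair_μ_map {a b c d : C} (x : 𝟙_ V ⟶ G.obj a) (y : 𝟙_ V ⟶ G.obj b) (f : a ⟶ c) (g : b ⟶ d) :
    pair x y ≫ μ G a b ≫ G.map (f ⊗ₘ g) = pair (x ≫ G.map f) (y ≫ G.map g) ≫ μ G c d := by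
  rw [← μ_natural, ← Category.assoc, pair_tensorHom]

lemma pair_μ_map_whiskerRight {a b c : C} (x : 𝟙_ V ⟶ G.obj a) (y : 𝟙_ V ⟶ G.obj b) (f : a ⟶ c) :
    pair x y ≫ μ G a b ≫ G.map (f ▷ b) = pair (x ≫ G.map f) y ≫ μ G c b := by
  rw [← μ_natural_left, pair_whiskerRight_assoc]

lemma pair_μ_map_whiskerLeft {a b c : C} (x : 𝟙_ V ⟶ G.obj a) (y : 𝟙_ V ⟶ G.obj b) (f : b ⟶ c) :
    pair x y ≫ μ G a b ≫ G.map (a ◁ f) = pair x (y ≫ G.map f) ≫ μ G a c := by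
  rw [← μ_natural_right, pair_whiskerLeft_assoc]

lemma pair_ε_μ {a : C} (x : 𝟙_ V ⟶ G.obj a) :
    pair (ε G) x ≫ μ G (𝟙_ C) a ≫ G.map (λ_ a).hom = x := by
  have h := congr(pair (𝟙 _) x ≫ $(left_unitality G a))
  rw [pair_whiskerRight_assoc, Category.id_comp, ← comp_leftUnitor_inv] at h
  simpa using h.symm

lemma pair_μ_ε {a : C} (x : 𝟙_ V ⟶ G.obj a) :
    pair x (ε G) ≫ μ G a (𝟙_ C) ≫ G.map (ρ_ a).hom = x := by
  have h := congr(pair x (𝟙 _) ≫ $(right_unitality G a))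
  rw [pair_whiskerLeft_assoc, Category.id_comp, ← comp_rightUnitor_inv] at h
  simpa using h.symm

lemma pair_μ_associator {a b c : C} (x : 𝟙_ V ⟶ G.obj a) (y : 𝟙_ V ⟶ G.obj b)
    (z : 𝟙_ V ⟶ G.obj c) :
    pair (pair x y ≫ μ G a b) z ≫ μ G (a ⊗ b) c ≫ G.map (α_ a b c).hom =
      pair x (pair y z ≫ μ G b c) ≫ μ G a (b ⊗ c) := by
  rw [← pair_whiskerRight_assoc, associativity, pair_associator_assoc, pair_whiskerLeft_assoc]

/-- The product of elements of `G a` and `G b` is classified by `P ⟶ P ⊗ P ⟶ a ⊗ b`. -/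
lemma hat_pair_μ_comp_tensorHom {a b : C} (x : 𝟙_ V ⟶ G.obj a) (y : 𝟙_ V ⟶ G.obj b) :
    hat adj (pair (universalElement adj) (universalElement adj) ≫ μ G _ _) ≫
      (hat adj x ⊗ₘ hat adj y) = hat adj (pair x y ≫ μ G a b) := by
  rw [hat_comp, Category.assoc, pair_μ_map, universalElement_hat, universalElement_hat]

/-- The object `P` representing a lax monoidal functor `G` is a comonoid, the comultiplication and
the counit of which classify `G_{P,P} (η ⊗ η)` and `G_0`, where `η` is the universal element. -/
abbrev representingComon : ComonObj (F.obj (𝟙_ V)) where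
  counit := hat adj (ε G)
  comul := hat adj (pair (universalElement adj) (universalElement adj) ≫ μ G _ _)
  counit_comul := by
    apply hom_ext_universalElement adj
    rw [G.map_comp, ← Category.assoc, universalElement_hat, Category.assoc,
      pair_μ_map_whiskerRight, universalElement_hat, ← cancel_mono (G.map (λ_ _).hom),
      Category.assoc, pair_ε_μ, Category.assoc, ← G.map_comp, Iso.inv_hom_id]
    simp
  comul_counit := by
    apply hom_ext_universalElement adj
    rw [G.map_comp, ← Category.assoc, universalElement_hat, Category.assoc,
      pair_μ_map_whiskerLeft, universalElement_hat, ← cancel_mono (G.map (ρ_ _).hom),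
      Category.assoc, pair_μ_ε, Category.assoc, ← G.map_comp, Iso.inv_hom_id]
    simp
  comul_assoc := by
    apply hom_ext_universalElement adj
    rw [G.map_comp, ← Category.assoc, universalElement_hat, Category.assoc,
      pair_μ_map_whiskerLeft, universalElement_hat, G.map_comp, ← Category.assoc,
      universalElement_hat, G.map_comp, ← Category.assoc, Category.assoc (pair _ _),
      pair_μ_map_whiskerRight, universalElement_hat, Category.assoc, pair_μ_associator]

end Comonoid

/-! ### The bialgebroid of an essentially strong monoidal functor -/

section Reconstruction
variable {V : Type u} [Category.{v} V] [MonoidalCategory V] [SymmetricCategory V]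
  [MonoidalClosed V] [UnitGenerator V] [HasCoequalizers V]
variable {C : Type*} [Category* C] [MonoidalCategory C] {G : C ⥤ V} [G.LaxMonoidal]
  {F : V ⥤ C} {adj : F ⊣ G}

open Functor.LaxMonoidal in
lemma pair_μ_balanced {a b : C} (x : 𝟙_ V ⟶ G.obj a) (r : 𝟙_ V ⟶ G.obj (𝟙_ C))
    (y : 𝟙_ V ⟶ G.obj b) :
    pair (pair x r ≫ μ G a (𝟙_ C) ≫ G.map (ρ_ a).hom) y ≫ μ G a b =
      pair x (pair r y ≫ μ G (𝟙_ C) b ≫ G.map (λ_ b).hom) ≫ μ G a b := by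
  have h := congr(pair (pair x r) y ≫ $(lax_balanced G a b))
  rwa [pair_whiskerRight_assoc, pair_associator_assoc, pair_whiskerLeft_assoc] at h

namespace RepresentingAction
variable (S : RepresentingAction adj)
open Functor.LaxMonoidal

variable (adj) in
/-- The source map `r ↦ η r` of `G e` into `G P`, where `η` is the universal element. -/
def source : (baseMon G).X ⟶ G.obj (F.obj (𝟙_ V)) :=
  (λ_ _).inv ≫ universalElement adj ▷ _ ≫ (canonicalObj G _).actRight

variable (adj) in
/-- The target map `r ↦ r η` of `G e` into `G P`, where `η` is the universal element. -/
def target : (baseMon G).X ⟶ G.obj (F.obj (𝟙_ V)) :=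
  (ρ_ _).inv ≫ _ ◁ universalElement adj ≫ (canonicalObj G _).actLeft

lemma comp_source (r : 𝟙_ V ⟶ (baseMon G).X) :
    r ≫ source adj = pair (universalElement adj) r ≫ (canonicalObj G _).actRight :=
  (pair_eq_comp _ _ _).symm

lemma comp_target (r : 𝟙_ V ⟶ (baseMon G).X) :
    r ≫ target adj = pair r (universalElement adj) ≫ (canonicalObj G _).actLeft :=
  (pair_eq_comp' _ _ _).symm

lemma pair_act_source {c : C} (x : 𝟙_ V ⟶ G.obj c) (r : 𝟙_ V ⟶ (baseMon G).X) :
    pair x (r ≫ source adj) ≫ S.act c = pair x r ≫ (canonicalObj G c).actRight := by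
  rw [S.pair_act, comp_source]
  refine (Category.assoc _ _ _).trans ?_
  refine (pair_actRight_hom ((canonical G).map (hat adj x)) r (universalElement adj)).trans ?_
  exact congr(pair $(universalElement_hat adj x) r ≫ _)

lemma pair_act_target {c : C} (x : 𝟙_ V ⟶ G.obj c) (r : 𝟙_ V ⟶ (baseMon G).X) :
    pair x (r ≫ target adj) ≫ S.act c = pair r x ≫ (canonicalObj G c).actLeft := by
  rw [S.pair_act, comp_target]
  refine (Category.assoc _ _ _).trans ?_
  refine (pair_actLeft_hom ((canonical G).map (hat adj x)) r (universalElement adj)).trans ?_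
  exact congr(pair r $(universalElement_hat adj x) ≫ _)

/-- The monoid `G P` with the source and target maps from `G e`. -/
abbrev sourceTargetRing : SourceTargetRing V where
  R := baseMon G
  A := S.mon
  s :=
    { hom := source adj
      isMonHom_hom :=
        letI := S.mon.mon
        { one_hom := (comp_source _).trans (pair_actRight_one (canonicalObj G _) _)
          mul_hom := by
            apply ext_pair
            intro r r'
            rw [pair_tensorHom_assoc, ← Category.assoc, comp_source]
            refine Eq.trans ?_ (S.pair_act_source (r ≫ source adj) r').symm
            rw [comp_source]
            exact pair_actRight_mul (canonicalObj G _) _ r r' } }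
  t := target adj
  one_t := (comp_target _).trans (pair_one_actLeft (canonicalObj G _) _)
  mul_t := by
    apply ext_pair
    intro r r'
    rw [pair_braiding_assoc, pair_tensorHom_assoc, ← Category.assoc, comp_target]
    refine Eq.trans ?_ (S.pair_act_target (r' ≫ target adj) r).symm
    rw [comp_target]
    exact pair_mul_actLeft (canonicalObj G _) r r' _
  comm := by
    apply ext_pair
    intro r r'
    rw [pair_braiding_assoc, pair_tensorHom_assoc, pair_tensorHom_assoc]
    refine (S.pair_act_target (r ≫ source adj) r').trans
      (Eq.trans ?_ (S.pair_act_source (r' ≫ target adj) r).symm)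
    rw [comp_source, comp_target]
    exact (pair_actLeft_actRight (canonicalObj G _) r' _ r).symm

/-- The functor `c ↦ G c` from `C` to bimodules that factors through the right modules. -/
abbrev toBimod : C ⥤ Bimod (baseMon G) (baseMon G) := S.comparison ⋙ S.sourceTargetRing.restrict

/-- The bimodule structures of `G c` that come from the monoidal structure of `G` and from the
action of `G P` coincide. -/
def canonicalIso : canonical G ≅ S.toBimod :=
  NatIso.ofComponents
    (fun c => Bimod.isoOfIso (P := canonicalObj G c) (Q := S.toBimod.obj c) (Iso.refl (G.obj c))
      (by
        apply ext_pair
        intro r x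
        rw [Iso.refl_hom, Category.comp_id, whiskerLeft_id, Category.id_comp]
        exact ((S.sourceTargetRing.pair_actLeft (S.comparison.obj c) r x).trans
          (S.pair_act_target x r)).symm)
      (by
        apply ext_pair
        intro x r
        rw [Iso.refl_hom, Category.comp_id, id_whiskerRight, Category.id_comp]
        exact ((S.sourceTargetRing.pair_actRight (S.comparison.obj c) r x).trans
          (S.pair_act_source x r)).symm))
    (fun f => Bimod.hom_ext _ _ ((Category.comp_id _).trans (Category.id_comp _).symm))

variable [hG : Fact (EssentiallyStrong G)]

/-- The canonical functor of an essentially strong monoidal functor is strong monoidal. -/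
noncomputable instance : (canonical G).Monoidal :=
  have := hG.out.1
  have := hG.out.2
  Functor.Monoidal.ofLaxMonoidal _

noncomputable instance : S.toBimod.Monoidal := Functor.Monoidal.transport S.canonicalIso

lemma ε_toBimod_hom : (ε S.toBimod).hom = 𝟙 (G.obj (𝟙_ C)) :=
  Category.comp_id _

lemma η_toBimod_hom : (Functor.OplaxMonoidal.η S.toBimod).hom = 𝟙 (G.obj (𝟙_ C)) := by
  have h := congr(($(Functor.Monoidal.ε_η S.toBimod)).hom)
  rw [Bimod.comp_hom', ε_toBimod_hom] at h
  exact (Category.id_comp _).symm.trans h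

lemma proj_μ_toBimod (c d : C) :
    proj (S.toBimod.obj c) (S.toBimod.obj d) ≫ (μ S.toBimod c d).hom = μ G c d := by
  have h : (μ S.toBimod c d) = (S.canonicalIso.inv.app c ⊗ₘ S.canonicalIso.inv.app d) ≫
    canonicalμ G c d ≫ S.canonicalIso.hom.app (c ⊗ d) := rfl
  have e : proj (S.toBimod.obj c) (S.toBimod.obj d) ≫
      (S.canonicalIso.inv.app c ⊗ₘ S.canonicalIso.inv.app d).hom = _ :=
    proj_tensorHom (S.canonicalIso.inv.app c) (S.canonicalIso.inv.app d)
  have e' : (S.canonicalIso.inv.app c).hom ⊗ₘ (S.canonicalIso.inv.app d).hom =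
    𝟙 (G.obj c ⊗ G.obj d) := id_tensorHom_id _ _
  rw [h, Bimod.comp_hom', Bimod.comp_hom', ← Category.assoc, e, e']
  have e'' : (canonicalμ G c d).hom ≫ (S.canonicalIso.hom.app (c ⊗ d)).hom =
    (canonicalμ G c d).hom := Category.comp_id _
  rw [e'']
  exact congr($(Category.id_comp _) ≫ _).trans (proj_canonicalμ G c d)

lemma mulLeft_eq_map (a : 𝟙_ V ⟶ G.obj (F.obj (𝟙_ V))) :
    S.sourceTargetRing.mulLeft a = S.toBimod.map (hat adj a) :=
  congr(S.sourceTargetRing.restrictMap $(S.comp_orbit a))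

lemma orbit_eq_map {c : C} (x : 𝟙_ V ⟶ G.obj c) :
    S.sourceTargetRing.orbit (X := S.comparison.obj c) x = S.toBimod.map (hat adj x) :=
  congr(S.sourceTargetRing.restrictMap $(S.comp_orbit x))

/-- The comonoid of bimodules `G P`. -/
noncomputable abbrev bimodComon : ComonObj (S.toBimod.obj (F.obj (𝟙_ V))) :=
  letI := representingComon adj
  Functor.obj.instComonObj _ _

lemma comul_comp_map_hat {c d : C} (x : 𝟙_ V ⟶ G.obj c) (y : 𝟙_ V ⟶ G.obj d) :
    S.bimodComon.comul ≫ (S.toBimod.map (hat adj x) ⊗ₘ S.toBimod.map (hat adj y)) =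
      S.toBimod.map (hat adj (pair x y ≫ μ G c d)) ≫ Functor.OplaxMonoidal.δ S.toBimod c d := by
  rw [← hat_pair_μ_comp_tensorHom, S.toBimod.map_comp, Category.assoc,
    ← Functor.OplaxMonoidal.δ_natural]
  exact Category.assoc _ _ _

lemma map_hat_universalElement :
    S.toBimod.map (hat adj (universalElement adj)) = 𝟙 (S.toBimod.obj (F.obj (𝟙_ V))) := by
  rw [hat_universalElement, S.toBimod.map_id]

/-- The monoid `G P` with the comultiplication induced by that of `P`. -/
noncomputable abbrev preBialgebroid : PreBialgebroid V where
  toSourceTargetRing := S.sourceTargetRing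
  comul := S.bimodComon.comul
  takeuchi r := by
    have e (a : 𝟙_ V ⟶ G.obj (F.obj (𝟙_ V))) :
        S.bimodComon.comul ≫ S.sourceTargetRing.mulLeft a ▷ _ =
          S.toBimod.map (hat adj (pair a (universalElement adj) ≫ μ G _ _)) ≫
            Functor.OplaxMonoidal.δ S.toBimod _ _ := by
      rw [← comul_comp_map_hat, map_hat_universalElement, tensorHom_id, mulLeft_eq_map]
    have e' (a : 𝟙_ V ⟶ G.obj (F.obj (𝟙_ V))) :
        S.bimodComon.comul ≫ _ ◁ S.sourceTargetRing.mulLeft a =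
          S.toBimod.map (hat adj (pair (universalElement adj) a ≫ μ G _ _)) ≫
            Functor.OplaxMonoidal.δ S.toBimod _ _ := by
      rw [← comul_comp_map_hat, map_hat_universalElement, id_tensorHom, mulLeft_eq_map]
    have h : pair (r ≫ source adj) (universalElement adj) ≫ μ G _ _ =
        pair (universalElement adj) (r ≫ target adj) ≫ μ G _ _ := by
      rw [comp_source, comp_target]
      exact pair_μ_balanced _ _ _
    refine (e _).trans (Eq.trans ?_ (e' _).symm)
    exact congr(S.toBimod.map (hat adj $h) ≫ _)

lemma pair_proj_μ_toBimod {c d : C} (x : 𝟙_ V ⟶ G.obj c) (y : 𝟙_ V ⟶ G.obj d) :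
    (pair x y ≫ proj (S.toBimod.obj c) (S.toBimod.obj d)) ≫ (μ S.toBimod c d).hom =
      pair x y ≫ μ G c d :=
  (Category.assoc _ _ _).trans congr(pair x y ≫ $(S.proj_μ_toBimod c d))

/-- The diagonal action on `G c ⊗_R G d` is the action on `G (c ⊗ d)`. -/
lemma tensorAct_μ_toBimod (c d : C) :
    S.preBialgebroid.tensorAct (S.comparison.obj c) (S.comparison.obj d) ≫
        (μ S.toBimod c d).hom =
      (μ S.toBimod c d).hom ▷ G.obj (F.obj (𝟙_ V)) ≫ S.act (c ⊗ d) := by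
  apply proj_whiskerRight_ext
  intro x y a
  have h₁ := S.preBialgebroid.pair_tensorAct (S.comparison.obj c) (S.comparison.obj d) x y a
  have h₂ : S.preBialgebroid.comul ≫
      (S.sourceTargetRing.orbit (X := S.comparison.obj c) x ⊗ₘ
        S.sourceTargetRing.orbit (X := S.comparison.obj d) y) ≫ μ S.toBimod c d =
      S.toBimod.map (hat adj (pair x y ≫ μ G c d)) := by
    rw [S.orbit_eq_map, S.orbit_eq_map, ← Category.assoc, comul_comp_map_hat, Category.assoc,
      Functor.Monoidal.δ_μ, Category.comp_id]
  rw [← Category.assoc, h₁, pair_whiskerRight_assoc]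
  refine Eq.trans ?_ congr(pair $((S.pair_proj_μ_toBimod x y).symm) a ≫ S.act (c ⊗ d))
  rw [S.pair_act, Category.assoc]
  refine congr(a ≫ $(?_))
  rw [← Category.assoc] at h₂
  exact congr(($h₂).hom)

lemma comul_μ : S.preBialgebroid.comul.hom ≫ (μ S.toBimod _ _).hom =
    G.map (hat adj (pair (universalElement adj) (universalElement adj) ≫ μ G _ _)) := by
  have : S.preBialgebroid.comul ≫ μ S.toBimod _ _ =
      S.toBimod.map (hat adj (pair (universalElement adj) (universalElement adj) ≫ μ G _ _)) := by
    refine (Category.assoc _ _ _).trans ?_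
    rw [Functor.Monoidal.δ_μ]
    exact Category.comp_id _
  exact congr(($this).hom)

instance (c d : C) : Mono (μ S.toBimod c d).hom :=
  inferInstanceAs (Mono ((Bimod.forget _).map (μ S.toBimod c d)))

lemma counit_hom : (S.bimodComon.counit).hom = G.map (hat adj (ε G)) :=
  congr(G.map (hat adj (ε G)) ≫ $(S.η_toBimod_hom)).trans (Category.comp_id _)

lemma source_counit : source adj ≫ G.map (hat adj (ε G)) = 𝟙 (G.obj (𝟙_ C)) := by
  apply ext_one
  intro r
  rw [← Category.assoc]
  refine congr($(comp_source r) ≫ _).trans ((Category.assoc _ _ _).trans ?_)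
  refine (pair_actRight_hom ((canonical G).map (hat adj (ε G))) r (universalElement adj)).trans ?_
  refine congr(pair $(universalElement_hat adj (ε G)) r ≫ _).trans ?_
  exact congr(pair (ε G) r ≫ μ G _ _ ≫ G.map $(unitors_equal.symm)).trans
    ((pair_ε_μ r).trans (Category.comp_id r).symm)

lemma target_counit : target adj ≫ G.map (hat adj (ε G)) = 𝟙 (G.obj (𝟙_ C)) := by
  apply ext_one
  intro r
  rw [← Category.assoc]
  refine congr($(comp_target r) ≫ _).trans ((Category.assoc _ _ _).trans ?_)
  refine (pair_actLeft_hom ((canonical G).map (hat adj (ε G))) r (universalElement adj)).trans ?_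
  refine congr(pair r $(universalElement_hat adj (ε G)) ≫ _).trans ?_
  exact congr(pair r (ε G) ≫ μ G _ _ ≫ G.map $(unitors_equal)).trans
    ((pair_μ_ε r).trans (Category.comp_id r).symm)

/-- A section of the counit may be inserted into the first factor of a product before the counit
is applied. -/
lemma whiskerRight_act_counit (σ : G.obj (𝟙_ C) ⟶ G.obj (F.obj (𝟙_ V)))
    (h : σ ≫ G.map (hat adj (ε G)) = 𝟙 _) :
    (G.map (hat adj (ε G)) ≫ σ) ▷ _ ≫ S.act _ ≫ G.map (hat adj (ε G)) =
      S.act _ ≫ G.map (hat adj (ε G)) := by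
  rw [S.act_naturality, ← comp_whiskerRight_assoc, Category.assoc, h, Category.comp_id]

/-- The bialgebroid `G P` of an essentially strong monoidal functor `G` represented by `P`. -/
noncomputable def bialgebroid : RightBialgebroid V where
  toPreBialgebroid := S.preBialgebroid
  counit := S.bimodComon.counit
  comul_counit := S.bimodComon.counit_comul
  counit_comul := S.bimodComon.comul_counit
  coassoc := S.bimodComon.comul_assoc.symm
  one_comul := by
    rw [← cancel_mono (μ S.toBimod _ _).hom]
    refine Eq.trans ?_ (S.pair_proj_μ_toBimod _ _).symm
    refine (Category.assoc _ _ _).trans (congr(_ ≫ $(S.comul_μ)).trans ?_)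
    exact universalElement_hat adj _
  mul_comul := by
    rw [← cancel_mono (μ S.toBimod _ _).hom]
    have h := S.act_naturality
      (hat adj (pair (universalElement adj) (universalElement adj) ≫ μ G _ _))
    rw [← S.comul_μ] at h
    refine (Category.assoc _ _ _).trans (h.trans ?_)
    rw [comp_whiskerRight, Category.assoc, ← S.tensorAct_μ_toBimod]
    exact (Category.assoc _ _ _).symm
  one_counit := by
    rw [counit_hom]
    exact (universalElement_hat adj _).trans (baseMon_one G).symm
  s_counit := by
    rw [counit_hom]
    exact S.whiskerRight_act_counit _ source_counit
  t_counit := by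
    rw [counit_hom]
    exact S.whiskerRight_act_counit _ target_counit

end RepresentingAction

end Reconstruction

/-! ### The comparison functor is strong monoidal -/

section Lift
variable {C D E : Type*} [Category* C] [Category* D] [Category* E] [MonoidalCategory C]
  [MonoidalCategory D] [MonoidalCategory E]
open Functor.LaxMonoidal

/-- The axioms of a strong monoidal structure on `K` may be checked after composition with a
faithful strong monoidal functor. -/
abbrev coreMonoidalOfComp (K : C ⥤ D) (Φ : D ⥤ E) [Φ.Monoidal] [Φ.Faithful]
    [(K ⋙ Φ).LaxMonoidal]
    (εIso : 𝟙_ D ≅ K.obj (𝟙_ C)) (μIso : ∀ X Y, K.obj X ⊗ K.obj Y ≅ K.obj (X ⊗ Y))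
    (hε : ε Φ ≫ Φ.map εIso.hom = ε (K ⋙ Φ))
    (hμ : ∀ X Y, μ Φ _ _ ≫ Φ.map (μIso X Y).hom = μ (K ⋙ Φ) X Y) : K.CoreMonoidal where
  εIso := εIso
  μIso := μIso
  μIso_hom_natural_left f Z := Φ.map_injective <| by
    have h := μ_natural_left (K ⋙ Φ) f Z
    rw [← hμ, ← hμ] at h
    rw [← cancel_epi (μ Φ _ _), Φ.map_comp, Φ.map_comp, ← μ_natural_left_assoc]
    simpa using h
  μIso_hom_natural_right Z f := Φ.map_injective <| by
    have h := μ_natural_right (K ⋙ Φ) Z f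
    rw [← hμ, ← hμ] at h
    rw [← cancel_epi (μ Φ _ _), Φ.map_comp, Φ.map_comp, ← μ_natural_right_assoc]
    simpa using h
  associativity X Y Z := Φ.map_injective <| by
    have h := associativity (K ⋙ Φ) X Y Z
    simp only [← hμ] at h
    rw [← cancel_epi (μ Φ _ _), ← cancel_epi (μ Φ _ _ ▷ _)]
    simp only [Φ.map_comp, ← μ_natural_left_assoc, associativity_assoc, ← μ_natural_right_assoc]
    simpa using h
  left_unitality X := Φ.map_injective <| by
    have h := left_unitality (K ⋙ Φ) X
    rw [← hε, ← hμ] at h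
    rw [← cancel_epi (μ Φ _ _), ← cancel_epi (ε Φ ▷ _), ← left_unitality]
    simp only [Φ.map_comp, ← μ_natural_left_assoc]
    simpa using h
  right_unitality X := Φ.map_injective <| by
    have h := right_unitality (K ⋙ Φ) X
    rw [← hε, ← hμ] at h
    rw [← cancel_epi (μ Φ _ _), ← cancel_epi (_ ◁ ε Φ), ← right_unitality]
    simp only [Φ.map_comp, ← μ_natural_right_assoc]
    simpa using h

end Lift

section OverEquivalence
variable {C D V : Type*} [Category* C] [Category* D] [Category* V]

/-- An equivalence of categories that is compatible with functors to `V` is an equivalence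
over `V`. -/
def EquivalenceOver.ofEquivalence {G : C ⥤ V} {H : D ⥤ V} (e : C ≌ D) (θ : e.functor ⋙ H ≅ G) :
    EquivalenceOver G H where
  functor := e.functor
  functorIso := θ
  inverse := e.inverse
  inverseIso := Functor.isoWhiskerLeft e.inverse θ.symm ≪≫ (Functor.associator _ _ _).symm ≪≫
    Functor.isoWhiskerRight e.counitIso H ≪≫ H.leftUnitor
  unitIso := e.unitIso
  counitIso := e.counitIso
  unit_over c := by
    have h := congr(H.map $(e.functor_unit_comp c))
    have h' := θ.inv.naturality (e.unitIso.hom.app c)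
    dsimp at h h' ⊢
    rw [H.map_comp, H.map_id] at h
    simp only [Category.id_comp, Category.comp_id, Category.assoc]
    rw [reassoc_of% h', reassoc_of% h]
    simp
  counit_over d := by simp

variable [MonoidalCategory C] [MonoidalCategory D] [MonoidalCategory V]

/-- A monoidal equivalence of categories that is compatible with monoidal functors to `V` is a
monoidal equivalence over `V`. -/
def EquivalenceOver.monoidalStructureOfIsMonoidal {G : C ⥤ V} {H : D ⥤ V}
    [G.LaxMonoidal] [H.LaxMonoidal] (e : C ≌ D) [e.functor.Monoidal] [e.inverse.Monoidal]
    [e.IsMonoidal] (θ : e.functor ⋙ H ≅ G) [NatTrans.IsMonoidal θ.hom] :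
    (EquivalenceOver.ofEquivalence e θ).MonoidalStructure where
  functor := inferInstanceAs e.functor.Monoidal
  inverse := inferInstanceAs e.inverse.Monoidal
  functorIso := inferInstanceAs (NatTrans.IsMonoidal θ.hom)
  inverseIso := inferInstanceAs (NatTrans.IsMonoidal (Functor.whiskerLeft e.inverse θ.inv ≫
    (Functor.associator _ _ _).inv ≫ Functor.whiskerRight e.counitIso.hom H ≫
      H.leftUnitor.hom))
  unitIso := inferInstanceAs (NatTrans.IsMonoidal e.unit)
  counitIso := inferInstanceAs (NatTrans.IsMonoidal e.counit)

lemma isMonoidal_inverseMonoidal (e : C ≌ D) [e.functor.Monoidal] :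
    letI := e.inverseMonoidal
    e.IsMonoidal :=
  letI := e.inverseMonoidal
  { leftAdjoint_ε := rfl
    leftAdjoint_μ := fun _ _ => rfl }

/-- The inverse of a strong monoidal equivalence over `V` is strong monoidal over `V` as well. -/
noncomputable def EquivalenceOver.monoidalStructureOfEquivalence {G : C ⥤ V} {H : D ⥤ V}
    [G.LaxMonoidal] [H.LaxMonoidal] (e : C ≌ D) [e.functor.Monoidal]
    (θ : e.functor ⋙ H ≅ G) (hθ : NatTrans.IsMonoidal θ.hom) :
    (EquivalenceOver.ofEquivalence e θ).MonoidalStructure :=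
  letI := e.inverseMonoidal
  haveI : e.IsMonoidal := isMonoidal_inverseMonoidal e
  monoidalStructureOfIsMonoidal e θ

end OverEquivalence

section Reconstruction
variable {V : Type u} [Category.{v} V] [MonoidalCategory V] [SymmetricCategory V]
  [MonoidalClosed V] [UnitGenerator V] [HasCoequalizers V]
variable {C : Type*} [Category* C] [MonoidalCategory C] {G : C ⥤ V} [G.LaxMonoidal]
  {F : V ⥤ C} {adj : F ⊣ G}

namespace RepresentingAction
variable (S : RepresentingAction adj) [hG : Fact (EssentiallyStrong G)]
open Functor.LaxMonoidal

/-- The comparison functor to the monoidal category of modules over the bialgebroid `G P`. -/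
noncomputable def toMod : C ⥤ S.bialgebroid.Mod := S.comparison

noncomputable instance : (S.toMod ⋙ S.bialgebroid.toBimod).LaxMonoidal :=
  inferInstanceAs S.toBimod.LaxMonoidal

/-- The isomorphism `R ≅ G e` of modules; the underlying arrow is the identity. -/
noncomputable def εToMod : 𝟙_ S.bialgebroid.Mod ≅ S.toMod.obj (𝟙_ C) :=
  S.bialgebroid.liftIso (P := S.bialgebroid.tensorUnit) (Q := S.comparison.obj (𝟙_ C))
    (S.bialgebroid.unitIso.symm ≪≫ Functor.Monoidal.εIso S.toBimod)
    (by
      have h : (S.bialgebroid.unitIso.symm ≪≫ Functor.Monoidal.εIso S.toBimod).hom.hom =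
          𝟙 (G.obj (𝟙_ C)) := (Category.id_comp _).trans S.ε_toBimod_hom
      refine congr((source adj ▷ _ ≫ S.act _ ≫ S.bimodComon.counit.hom) ≫ $h).trans
        (Eq.trans ?_ congr($(h.symm) ▷ S.mon.X ≫ S.act (𝟙_ C)))
      refine (Category.comp_id _).trans (Eq.trans ?_ congr($((id_whiskerRight _ _).symm) ≫ _))
      refine Eq.trans ?_ (Category.id_comp _).symm
      refine congr(source adj ▷ _ ≫ S.act _ ≫ $(S.counit_hom)).trans ?_
      refine congr(source adj ▷ _ ≫ $(S.act_naturality _)).trans ?_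
      rw [← comp_whiskerRight_assoc, source_counit]
      exact congr($(id_whiskerRight _ _) ≫ _).trans (Category.id_comp _))

/-- The isomorphism `G c ⊗_R G d ≅ G (c ⊗ d)` of modules. -/
noncomputable def μToMod (c d : C) :
    S.toMod.obj c ⊗ S.toMod.obj d ≅ S.toMod.obj (c ⊗ d) :=
  S.bialgebroid.liftIso (P := S.bialgebroid.tensorObj (S.comparison.obj c) (S.comparison.obj d))
    (Q := S.comparison.obj (c ⊗ d))
    ((S.bialgebroid.tensorIso (S.comparison.obj c) (S.comparison.obj d)).symm ≪≫
      Functor.Monoidal.μIso S.toBimod c d)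
    (by
      have h : ((S.bialgebroid.tensorIso (S.comparison.obj c) (S.comparison.obj d)).symm ≪≫
        Functor.Monoidal.μIso S.toBimod c d).hom.hom = (μ S.toBimod c d).hom :=
        Category.id_comp _
      refine congr(S.preBialgebroid.tensorAct (S.comparison.obj c) (S.comparison.obj d) ≫ $h).trans
        (Eq.trans ?_ congr($(h.symm) ▷ S.mon.X ≫ S.act (c ⊗ d)))
      exact S.tensorAct_μ_toBimod c d)

lemma ε_toBimod_comp_εToMod : ε S.bialgebroid.toBimod ≫ S.bialgebroid.toBimod.map S.εToMod.hom =
    ε S.toBimod :=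
  Iso.hom_inv_id_assoc S.bialgebroid.unitIso (ε S.toBimod)

lemma μ_toBimod_comp_μToMod (c d : C) :
    μ S.bialgebroid.toBimod _ _ ≫ S.bialgebroid.toBimod.map (S.μToMod c d).hom =
      μ S.toBimod c d :=
  Iso.hom_inv_id_assoc (S.bialgebroid.tensorIso _ _) (μ S.toBimod c d)

noncomputable instance : S.toMod.Monoidal :=
  (coreMonoidalOfComp S.toMod S.bialgebroid.toBimod S.εToMod S.μToMod S.ε_toBimod_comp_εToMod
    S.μ_toBimod_comp_μToMod).toMonoidal

/-- The comparison functor commutes with the functors to `V`. -/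
noncomputable def toModCompLongForget : S.toMod ⋙ S.bialgebroid.longForget ≅ G :=
  NatIso.ofComponents (fun c => Iso.refl (G.obj c))
    (fun _ => (Category.comp_id _).trans (Category.id_comp _).symm)

instance : NatTrans.IsMonoidal S.toModCompLongForget.hom where
  unit := by
    have h : (ε S.bialgebroid.toBimod).hom ≫ (S.bialgebroid.toBimod.map S.εToMod.hom).hom =
      𝟙 (G.obj (𝟙_ C)) := congr(($(S.ε_toBimod_comp_εToMod)).hom).trans S.ε_toBimod_hom
    refine (Category.comp_id _).trans ((Category.assoc _ _ _).trans ?_)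
    refine congr(MonObj.one (X := (baseMon G).X) ≫ $h).trans ?_
    exact (Category.comp_id _).trans (baseMon_one G)
  tensor c d := by
    have h : (μ S.bialgebroid.toBimod _ _).hom ≫
        (S.bialgebroid.toBimod.map (S.μToMod c d).hom).hom = (μ S.toBimod c d).hom :=
      congr(($(S.μ_toBimod_comp_μToMod c d)).hom)
    refine (Category.comp_id _).trans ((Category.assoc _ _ _).trans ?_)
    refine congr(proj (S.toBimod.obj c) (S.toBimod.obj d) ≫ $h).trans ?_
    refine (S.proj_μ_toBimod c d).trans (Eq.trans ?_ congr($((id_tensorHom_id _ _).symm) ≫ _))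
    exact (Category.id_comp _).symm

variable [Balanced V] [G.IsLeftAdjoint] [(Monad.comparison adj).IsEquivalence]

instance : S.toMod.IsEquivalence := S.isEquivalence_comparison

/-- The equivalence over `V` between `G` and the long forgetful functor of the bialgebroid `G P`. -/
noncomputable def equivalenceOver : EquivalenceOver G S.bialgebroid.longForget :=
  .ofEquivalence S.toMod.asEquivalence S.toModCompLongForget

/-- The equivalence with the modules over the bialgebroid `G P` is strong monoidal. -/
noncomputable def monoidalStructure : S.equivalenceOver.MonoidalStructure :=
  letI : S.toMod.asEquivalence.functor.Monoidal := inferInstanceAs S.toMod.Monoidal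
  EquivalenceOver.monoidalStructureOfEquivalence S.toMod.asEquivalence
    S.toModCompLongForget
    (inferInstanceAs (NatTrans.IsMonoidal S.toModCompLongForget.hom))

end RepresentingAction

end Reconstruction

/-! ### The forgetful functor of right modules -/

section Modules
variable {V : Type u} [Category.{v} V] [MonoidalCategory V] [SymmetricCategory V]
  [MonoidalClosed V] [UnitGenerator V] [HasCoequalizers V]

namespace RightModule
variable {A : Mon V}

variable (A) in
/-- The free right module `X ⊗ A`. -/
abbrev free (X : V) : RightModule A where
  X := X ⊗ A.X
  act := (α_ _ _ _).hom ≫ X ◁ MonObj.mul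
  act_one := by
    rw [associator_naturality_right_assoc, ← whiskerLeft_comp, MonObj.mul_one]
    simp
  act_mul := by
    have h : A.X ◁ MonObj.mul ≫ MonObj.mul =
        (α_ _ _ _).inv ≫ MonObj.mul ▷ A.X ≫ MonObj.mul (X := A.X) := by
      rw [MonObj.mul_assoc, Iso.inv_hom_id_assoc]
    have h' := congr(X ◁ $h)
    simp only [whiskerLeft_comp] at h'
    rw [associator_naturality_right_assoc, h']
    simp

variable (A) in
/-- Module morphisms `X ⊗ A ⟶ M` correspond to arrows `X ⟶ M` in `V`. -/
def freeHomEquiv (X : V) (M : RightModule A) : (free A X ⟶ M) ≃ (X ⟶ M.X) where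
  toFun f := (ρ_ X).inv ≫ X ◁ MonObj.one ≫ f.hom
  invFun g := ⟨g ▷ A.X ≫ M.act, by
    change ((α_ _ _ _).hom ≫ X ◁ MonObj.mul) ≫ _ = _
    rw [Category.assoc, whisker_exchange_assoc, M.act_mul]
    simp⟩
  left_inv f := by
    apply hom_ext
    change ((ρ_ X).inv ≫ X ◁ MonObj.one ≫ f.hom) ▷ A.X ≫ M.act = f.hom
    rw [comp_whiskerRight, comp_whiskerRight, Category.assoc, Category.assoc, ← f.act_hom]
    change _ ≫ _ ≫ ((α_ _ _ _).hom ≫ X ◁ MonObj.mul) ≫ _ = _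
    have h := congr(X ◁ $(MonObj.one_mul A.X))
    rw [whiskerLeft_comp] at h
    rw [Category.assoc, associator_naturality_middle_assoc, reassoc_of% h]
    simp
  right_inv g := by
    change (ρ_ X).inv ≫ X ◁ MonObj.one ≫ g ▷ A.X ≫ M.act = g
    rw [whisker_exchange_assoc, M.act_one]
    simp

instance : (forget A).IsRightAdjoint :=
  (Adjunction.adjunctionOfEquivLeft (freeHomEquiv A) (fun X M N g h => by
    change (ρ_ X).inv ≫ X ◁ MonObj.one ≫ h.hom ≫ g.hom =
      ((ρ_ X).inv ≫ X ◁ MonObj.one ≫ h.hom) ≫ g.hom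
    simp)).isRightAdjoint

/-- Elements of the internal hom `[X, Y]` are determined by their values at the elements of `X`. -/
lemma ihom_ext {X Y : V} {f g : 𝟙_ V ⟶ (ihom X).obj Y}
    (h : ∀ x : 𝟙_ V ⟶ X, pair x f ≫ (ihom.ev X).app Y = pair x g ≫ (ihom.ev X).app Y) : f = g := by
  apply MonoidalClosed.uncurry_injective
  rw [MonoidalClosed.uncurry_eq, MonoidalClosed.uncurry_eq, ← cancel_epi (ρ_ X).inv]
  apply ext_one
  intro x
  rw [← pair_eq_comp', ← pair_eq_comp', h]

lemma pair_curry {X Y Z : V} (f : X ⊗ Z ⟶ Y) (x : 𝟙_ V ⟶ X) (z : 𝟙_ V ⟶ Z) :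
    pair x (z ≫ MonoidalClosed.curry f) ≫ (ihom.ev X).app Y = pair x z ≫ f := by
  rw [← pair_whiskerLeft_assoc, ← MonoidalClosed.uncurry_eq, MonoidalClosed.uncurry_curry]

variable (A) in
/-- The right action `(f · a) b = f (a b)` of `A` on the internal hom `[A, Y]`. -/
def cofreeAct (Y : V) : (ihom A.X).obj Y ⊗ A.X ⟶ (ihom A.X).obj Y :=
  MonoidalClosed.curry (A.X ◁ (β_ _ _).hom ≫ (α_ _ _ _).inv ≫
    ((β_ _ _).hom ≫ MonObj.mul) ▷ _ ≫ (ihom.ev A.X).app Y)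

lemma pair_cofreeAct_ev {Y : V} (f : 𝟙_ V ⟶ (ihom A.X).obj Y) (a b : 𝟙_ V ⟶ A.X) :
    pair b (pair f a ≫ cofreeAct A Y) ≫ (ihom.ev A.X).app Y =
      pair (pair a b ≫ MonObj.mul) f ≫ (ihom.ev A.X).app Y := by
  rw [cofreeAct, pair_curry, pair_whiskerLeft_assoc, pair_braiding, pair_associator_inv_assoc,
    pair_whiskerRight_assoc, pair_braiding_assoc]

variable (A) in
/-- The cofree right module `[A, Y]`. -/
abbrev cofree (Y : V) : RightModule A :=
  ofElements ((ihom A.X).obj Y) (cofreeAct A Y)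
    (fun f => ihom_ext fun b => by rw [pair_cofreeAct_ev, pair_one_mul])
    (fun f a a' => ihom_ext fun b => by
      rw [pair_cofreeAct_ev, pair_cofreeAct_ev, pair_cofreeAct_ev, pair_mul_assoc])

variable (A) in
/-- Arrows `M ⟶ Y` in `V` correspond to module morphisms `M ⟶ [A, Y]`. -/
def cofreeHomEquiv (M : RightModule A) (Y : V) : (M.X ⟶ Y) ≃ (M ⟶ cofree A Y) where
  toFun g := ⟨MonoidalClosed.curry ((β_ _ _).hom ≫ M.act ≫ g), by
    apply ext_pair
    intro x a
    rw [pair_whiskerRight_assoc, ← Category.assoc]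
    apply ihom_ext
    intro b
    rw [pair_cofreeAct_ev, pair_curry, pair_curry, pair_braiding_assoc, pair_braiding_assoc,
      ← Category.assoc, pair_act_mul, Category.assoc]⟩
  invFun f := f.hom ≫ (λ_ _).inv ≫ MonObj.one ▷ _ ≫ (ihom.ev A.X).app Y
  left_inv g := by
    apply ext_one
    intro x
    change x ≫ MonoidalClosed.curry _ ≫ _ = _
    rw [← Category.assoc, ← pair_eq_comp, pair_curry, pair_braiding_assoc, ← Category.assoc,
      pair_act_one]
  right_inv f := by
    apply hom_ext
    apply ext_one
    intro x
    apply ihom_ext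
    intro a
    have h := pair_hom f x a
    change pair a (x ≫ MonoidalClosed.curry ((β_ _ _).hom ≫ M.act ≫ f.hom ≫ (λ_ _).inv ≫
      MonObj.one ▷ _ ≫ (ihom.ev A.X).app Y)) ≫ _ = _
    refine (pair_curry _ a x).trans ?_
    rw [pair_braiding_assoc, ← Category.assoc M.act, ← Category.assoc (pair x a), h]
    simp only [Category.assoc]
    refine ((Category.assoc _ _ _).symm.trans (pair_eq_comp _ _ _).symm).trans ?_
    exact (pair_cofreeAct_ev _ _ _).trans congr(pair $(pair_mul_one A a) _ ≫ _)

instance : (forget A).IsLeftAdjoint :=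
  (Adjunction.adjunctionOfEquivRight (cofreeHomEquiv A) (fun M N Y f g => by
    apply hom_ext
    apply ext_one
    intro x
    apply ihom_ext
    intro a
    refine (pair_curry _ a x).trans (Eq.trans ?_ (congr(pair a $(Category.assoc x f.hom _) ≫
      (ihom.ev A.X).app Y).symm.trans (pair_curry _ a (x ≫ f.hom))).symm)
    rw [pair_braiding_assoc, pair_braiding_assoc]
    change pair x a ≫ M.act ≫ f.hom ≫ g = pair (x ≫ f.hom) a ≫ N.act ≫ g
    exact (congr(pair x a ≫ $((Category.assoc M.act f.hom g).symm)).trans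
      (Category.assoc _ _ _).symm).trans (congr($(pair_hom f x a) ≫ g).trans
        (Category.assoc _ _ _)))).isLeftAdjoint

instance : (forget A).ReflectsIsomorphisms where
  reflects f h := (isoMk (@asIso _ _ _ _ f.hom h) f.act_hom).isIso_hom

section Coequalizer
variable {M N : RightModule A} (f g : M ⟶ N)

/-- The action on the coequalizer of the underlying arrows of two morphisms of modules. -/
noncomputable def coequalizerAct : coequalizer f.hom g.hom ⊗ A.X ⟶ coequalizer f.hom g.hom :=
  (PreservesCoequalizer.iso (tensorRight A.X) _ _).inv ≫
    coequalizer.desc (N.act ≫ coequalizer.π f.hom g.hom) (by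
      change f.hom ▷ A.X ≫ _ = g.hom ▷ A.X ≫ _
      rw [← reassoc_of% f.act_hom, ← reassoc_of% g.act_hom, coequalizer.condition])

lemma π_coequalizerAct : coequalizer.π f.hom g.hom ▷ A.X ≫ coequalizerAct f g =
    N.act ≫ coequalizer.π f.hom g.hom :=
  π_tensor_id_preserves_coequalizer_inv_desc _ _ _ _

lemma epi_whiskerRight {X Y : V} (p : X ⟶ Y) [Epi p] (Z : V) : Epi (p ▷ Z) :=
  inferInstanceAs (Epi ((tensorRight Z).map p))

/-- The coequalizer of two morphisms of modules. -/
noncomputable abbrev coequalizerObj : RightModule A where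
  X := coequalizer f.hom g.hom
  act := coequalizerAct f g
  act_one := by
    have := epi_whiskerRight (coequalizer.π f.hom g.hom) (𝟙_ V)
    rw [← cancel_epi (coequalizer.π f.hom g.hom ▷ 𝟙_ V), ← whisker_exchange_assoc,
      π_coequalizerAct, reassoc_of% N.act_one, rightUnitor_naturality]
  act_mul := by
    have := epi_whiskerRight (coequalizer.π f.hom g.hom) (A.X ⊗ A.X)
    rw [← cancel_epi (coequalizer.π f.hom g.hom ▷ (A.X ⊗ A.X)), ← whisker_exchange_assoc,
      π_coequalizerAct, reassoc_of% N.act_mul, associator_inv_naturality_left_assoc,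
      ← comp_whiskerRight_assoc, π_coequalizerAct, comp_whiskerRight_assoc, π_coequalizerAct]

instance : HasColimit (parallelPair f g) := by
  let π : N ⟶ coequalizerObj f g := ⟨coequalizer.π f.hom g.hom, (π_coequalizerAct f g).symm⟩
  refine ⟨⟨⟨Cofork.ofπ π (hom_ext (coequalizer.condition f.hom g.hom)),
    Cofork.IsColimit.mk _ (fun s => ⟨coequalizer.desc s.π.hom congr(($(s.condition)).hom), ?_⟩)
      ?_ ?_⟩⟩⟩
  · have := epi_whiskerRight (coequalizer.π f.hom g.hom) A.X
    rw [← cancel_epi (coequalizer.π f.hom g.hom ▷ A.X), ← Category.assoc]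
    refine congr($(π_coequalizerAct f g) ≫ _).trans ?_
    rw [Category.assoc, coequalizer.π_desc, ← comp_whiskerRight_assoc, coequalizer.π_desc]
    exact s.π.act_hom
  · intro s
    exact hom_ext (coequalizer.π_desc _ _)
  · intro s m h
    apply hom_ext
    change m.hom = coequalizer.desc _ _
    rw [← cancel_epi (coequalizer.π f.hom g.hom), coequalizer.π_desc]
    exact congr(($h).hom)

end Coequalizer

instance : HasCoequalizers (RightModule A) := hasCoequalizers_of_hasColimit_parallelPair _

end RightModule

end Modules

/-! ### Essential strength as a universal property -/

section Universal
open Functor.LaxMonoidal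
variable {V : Type*} [Category* V] [MonoidalCategory V]
variable {C D : Type*} [Category* C] [MonoidalCategory C] [Category* D] [MonoidalCategory D]

/-- The arrows `G_{a,b}` are universal among the arrows on `G a ⊗ G b` that are balanced over
`G e`. -/
structure UniversalTensors (G : C ⥤ V) [G.LaxMonoidal] : Prop where
  epi (a b : C) : Epi (μ G a b)
  exists_desc {a b : C} {Z : V} (f : G.obj a ⊗ G.obj b ⟶ Z)
    (balanced : (μ G a (𝟙_ C) ≫ G.map (ρ_ a).hom) ▷ G.obj b ≫ f =
      (α_ _ _ _).hom ≫ G.obj a ◁ (μ G (𝟙_ C) b ≫ G.map (λ_ b).hom) ≫ f) :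
    ∃ g : G.obj (a ⊗ b) ⟶ Z, μ G a b ≫ g = f

/-- Universality is preserved by precomposition with a strong monoidal functor. -/
lemma UniversalTensors.comp {H : D ⥤ V} [H.LaxMonoidal] (hH : UniversalTensors H) (K : C ⥤ D)
    [K.Monoidal] : UniversalTensors (K ⋙ H) where
  epi a b := by
    have := hH.epi (K.obj a) (K.obj b)
    rw [comp_μ]
    infer_instance
  exists_desc {a b Z} f hf := by
    -- Balanced over `H (K e)` implies balanced over `H e`: restrict along `H (K_0)`.
    have hr : H.obj (K.obj a) ◁ H.map (ε K) ≫ μ (K ⋙ H) a (𝟙_ C) ≫ (K ⋙ H).map (ρ_ a).hom =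
        μ H _ _ ≫ H.map (ρ_ (K.obj a)).hom := by
      simp only [comp_μ, Functor.comp_map, Category.assoc]
      rw [μ_natural_right_assoc, ← H.map_comp, ← H.map_comp, right_unitality K a]
    have hl : H.map (ε K) ▷ H.obj (K.obj b) ≫ μ (K ⋙ H) (𝟙_ C) b ≫ (K ⋙ H).map (λ_ b).hom =
        μ H _ _ ≫ H.map (λ_ (K.obj b)).hom := by
      simp only [comp_μ, Functor.comp_map, Category.assoc]
      rw [μ_natural_left_assoc, ← H.map_comp, ← H.map_comp, left_unitality K b]
    obtain ⟨g, hg⟩ := hH.exists_desc (a := K.obj a) (b := K.obj b) f (by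
      rw [← hr, ← hl, comp_whiskerRight, whiskerLeft_comp, Category.assoc, Category.assoc,
        ← associator_naturality_middle_assoc]
      exact congr((H.obj (K.obj a) ◁ H.map (ε K)) ▷ H.obj (K.obj b) ≫ $hf))
    refine ⟨H.map (Functor.OplaxMonoidal.δ K a b) ≫ g, ?_⟩
    rw [comp_μ, Category.assoc, ← H.map_comp_assoc, Functor.Monoidal.μ_δ, H.map_id,
      Category.id_comp, hg]

/-- Universality is preserved by monoidal natural isomorphisms. -/
lemma UniversalTensors.of_iso {G H : C ⥤ V} [G.LaxMonoidal] [H.LaxMonoidal]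
    (hH : UniversalTensors H) (θ : H ≅ G) [NatTrans.IsMonoidal θ.hom] : UniversalTensors G where
  epi a b := by
    have := hH.epi a b
    have h := NatTrans.IsMonoidal.tensor (τ := θ.hom) a b
    have : Epi ((θ.hom.app a ⊗ₘ θ.hom.app b) ≫ μ G a b) := by
      rw [← h]
      infer_instance
    exact epi_of_epi (θ.hom.app a ⊗ₘ θ.hom.app b) _
  exists_desc {a b Z} f hf := by
    have hr : (μ H a (𝟙_ C) ≫ H.map (ρ_ a).hom) ≫ θ.hom.app a =
        (θ.hom.app a ⊗ₘ θ.hom.app (𝟙_ C)) ≫ μ G _ _ ≫ G.map (ρ_ a).hom := by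
      rw [Category.assoc, θ.hom.naturality, ← Category.assoc, NatTrans.IsMonoidal.tensor,
        Category.assoc]
    have hl : (μ H (𝟙_ C) b ≫ H.map (λ_ b).hom) ≫ θ.hom.app b =
        (θ.hom.app (𝟙_ C) ⊗ₘ θ.hom.app b) ≫ μ G _ _ ≫ G.map (λ_ b).hom := by
      rw [Category.assoc, θ.hom.naturality, ← Category.assoc, NatTrans.IsMonoidal.tensor,
        Category.assoc]
    obtain ⟨g, hg⟩ := hH.exists_desc ((θ.hom.app a ⊗ₘ θ.hom.app b) ≫ f) (by
      rw [← tensorHom_id, ← id_tensorHom, tensorHom_comp_tensorHom_assoc,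
        tensorHom_comp_tensorHom_assoc, hr, hl, Category.id_comp, Category.id_comp]
      have h := congr(((θ.hom.app a ⊗ₘ θ.hom.app (𝟙_ C)) ⊗ₘ θ.hom.app b) ≫ $hf)
      rw [associator_naturality_assoc, ← tensorHom_id, ← id_tensorHom,
        tensorHom_comp_tensorHom_assoc, tensorHom_comp_tensorHom_assoc, Category.comp_id,
        Category.comp_id] at h
      exact h)
    refine ⟨θ.inv.app _ ≫ g, ?_⟩
    have h := NatTrans.IsMonoidal.tensor (τ := θ.hom) a b
    rw [← cancel_epi (θ.hom.app a ⊗ₘ θ.hom.app b), ← Category.assoc, ← h]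
    simpa using hg

/-- The lax monoidal structure transported along a natural isomorphism. -/
abbrev laxMonoidalOfIso {F G : C ⥤ V} [F.LaxMonoidal] (i : F ≅ G) : G.LaxMonoidal where
  ε := ε F ≫ i.hom.app _
  μ X Y := (i.inv.app X ⊗ₘ i.inv.app Y) ≫ μ F X Y ≫ i.hom.app (X ⊗ Y)
  μ_natural_left _ _ := by simp [NatTrans.whiskerRight_app_tensor_app_assoc]
  μ_natural_right _ _ := by simp [NatTrans.whiskerLeft_app_tensor_app_assoc]
  associativity X Y Z := by
    have h := congr(((i.inv.app X ⊗ₘ i.inv.app Y) ⊗ₘ i.inv.app Z) ≫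
      $(associativity F X Y Z) ≫ i.hom.app _)
    simp only [← tensorHom_id, ← id_tensorHom, Category.assoc, tensorHom_comp_tensorHom_assoc,
      associator_naturality_assoc, Category.comp_id, Category.id_comp, Iso.hom_inv_id_app,
      ← i.hom.naturality] at h ⊢
    exact h
  left_unitality X := by
    simp only [← tensorHom_id, Category.assoc, tensorHom_comp_tensorHom_assoc, Category.id_comp,
      Iso.hom_inv_id_app, Category.comp_id]
    rw [← i.hom.naturality, ← Category.comp_id (i.inv.app X), ← Category.id_comp (ε F),
      ← tensorHom_comp_tensorHom]
    simp
  right_unitality X := by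
    simp only [← id_tensorHom, Category.assoc, tensorHom_comp_tensorHom_assoc, Category.id_comp,
      Iso.hom_inv_id_app, Category.comp_id]
    rw [← i.hom.naturality, ← Category.comp_id (i.inv.app X), ← Category.id_comp (ε F),
      ← tensorHom_comp_tensorHom]
    simp

lemma isMonoidal_laxMonoidalOfIso {F G : C ⥤ V} [F.LaxMonoidal] (i : F ≅ G) :
    letI := laxMonoidalOfIso i
    NatTrans.IsMonoidal i.hom :=
  letI := laxMonoidalOfIso i
  { unit := rfl
    tensor := fun X Y => by
      change _ = _ ≫ (i.inv.app X ⊗ₘ i.inv.app Y) ≫ _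
      simp }

end Universal

section Criterion
open Functor.LaxMonoidal
variable {V : Type u} [Category.{v} V] [MonoidalCategory V] [SymmetricCategory V]
  [MonoidalClosed V] [UnitGenerator V] [HasCoequalizers V]
variable {C : Type*} [Category* C] [MonoidalCategory C]

lemma universalTensors_bimodForget (R : Mon V) : UniversalTensors (bimodForget R) where
  epi M N := inferInstanceAs (Epi (proj M N))
  exists_desc {M N Z} f hf := by
    have h : M.actRight ▷ N.X ≫ f = (α_ _ _ _).hom ≫ M.X ◁ N.actLeft ≫ f := by
      rw [← proj_leftUnitor, ← proj_rightUnitor]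
      exact hf
    exact ⟨projDesc f h, proj_projDesc f h⟩

lemma isIso_of_isIso_hom {R : Mon V} {M N : Bimod R R} (f : M ⟶ N) [IsIso f.hom] : IsIso f :=
  (Bimod.isoOfIso (asIso f.hom) f.left_act_hom f.right_act_hom).isIso_hom

/-- The comparison arrows of the canonical factorization are invertible because `G a ⊗_R G b` has
the universal property of `G (a ⊗ b)`. -/
lemma UniversalTensors.essentiallyStrong {G : C ⥤ V} [G.LaxMonoidal] (h : UniversalTensors G) :
    EssentiallyStrong G := by
  refine ⟨?_, fun a b => ?_⟩
  · have : IsIso (ε (canonical G)).hom := inferInstanceAs (IsIso (𝟙 (G.obj (𝟙_ C))))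
    exact isIso_of_isIso_hom _
  · obtain ⟨g, hg⟩ := h.exists_desc (proj (canonicalObj G a) (canonicalObj G b))
      (proj_condition (canonicalObj G a) (canonicalObj G b))
    have := h.epi a b
    have e : proj _ _ ≫ (canonicalμ G a b).hom = μ G a b := proj_canonicalμ G a b
    have : IsIso (canonicalμ G a b).hom := by
      refine ⟨g, ?_, ?_⟩
      · rw [← cancel_epi (proj _ _), reassoc_of% e]
        exact hg.trans (Category.comp_id _).symm
      · rw [← cancel_epi (μ G a b), reassoc_of% hg, e]
        exact (Category.comp_id _).symm
    exact isIso_of_isIso_hom (canonicalμ G a b)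

lemma RightBialgebroid.universalTensors_longForget (B : RightBialgebroid V) :
    UniversalTensors B.longForget :=
  (universalTensors_bimodForget B.R).comp B.toBimod

end Criterion

/-! ### Functors equivalent to long forgetful functors -/

section Transfer
variable {V : Type u} [Category.{v} V] {C D : Type*} [Category* C] [Category* D]
  {G : C ⥤ V} {H : D ⥤ V}

namespace EquivalenceOver

instance (E : EquivalenceOver G H) : E.functor.IsEquivalence :=
  Functor.IsEquivalence.mk' E.inverse E.unitIso E.counitIso

lemma isLeftAdjoint (E : EquivalenceOver G H) [H.IsLeftAdjoint] : G.IsLeftAdjoint :=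
  Functor.isLeftAdjoint_of_iso E.functorIso

lemma isRightAdjoint (E : EquivalenceOver G H) [H.IsRightAdjoint] : G.IsRightAdjoint :=
  Functor.isRightAdjoint_of_iso E.functorIso

lemma faithful (E : EquivalenceOver G H) [H.Faithful] : G.Faithful :=
  Functor.Faithful.of_iso E.functorIso

lemma reflectsIsomorphisms (E : EquivalenceOver G H) [H.ReflectsIsomorphisms] :
    G.ReflectsIsomorphisms :=
  reflectsIsomorphisms_of_iso E.functorIso

/-- The monoidal structures of `D` and `H` can be transported along an equivalence over `V`; the
universality of the tensors is preserved. -/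
lemma exists_universalTensors [MonoidalCategory V] [MonoidalCategory D] [H.LaxMonoidal]
    (E : EquivalenceOver G H) (hH : UniversalTensors H) :
    ∃ (_ : MonoidalCategory C) (_ : G.LaxMonoidal), UniversalTensors G :=
  letI := Monoidal.transport E.functor.asEquivalence.symm
  letI : E.functor.Monoidal := (inferInstance :
    (Monoidal.equivalenceTransported E.functor.asEquivalence.symm).inverse.Monoidal)
  letI := laxMonoidalOfIso E.functorIso
  haveI := isMonoidal_laxMonoidalOfIso E.functorIso
  ⟨inferInstance, inferInstance, (hH.comp E.functor).of_iso E.functorIso⟩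

section Linear
variable (k : Type*) [CommRing k] [Preadditive V] [Linear k V] [Preadditive C] [Linear k C]
  [Preadditive D] [Linear k D] [G.Additive] [G.Linear k] [H.Additive] [H.Linear k]
  [H.Faithful]

/-- Equivalences over `V` are linear, because the functors to `V` are faithful and linear. -/
lemma isLinear (E : EquivalenceOver G H) : E.IsLinear k := by
  have := E.faithful
  have := Functor.additive_of_iso E.functorIso.symm
  have := Functor.additive_of_iso E.inverseIso.symm
  have := Functor.linear_of_iso k E.functorIso.symm
  have := Functor.linear_of_iso k E.inverseIso.symm
  exact
    { functor_additive := Functor.additive_of_comp_faithful _ H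
      functor_linear := ⟨fun f r => H.map_injective
        (((E.functor ⋙ H).map_smul r f).trans (H.map_smul r _).symm)⟩
      inverse_additive := Functor.additive_of_comp_faithful _ G
      inverse_linear := ⟨fun f r => G.map_injective
        (((E.inverse ⋙ G).map_smul r f).trans (G.map_smul r _).symm)⟩ }

end Linear

end EquivalenceOver

section Bilinear
open Functor.LaxMonoidal
variable [Preadditive V] [MonoidalCategory V] [MonoidalPreadditive V] [Preadditive C]
  [MonoidalCategory C] [G.LaxMonoidal] [G.Faithful] [G.Additive]

lemma UniversalTensors.monoidalPreadditive (hG : UniversalTensors G) : MonoidalPreadditive C := by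
  have := hG.epi
  refine @MonoidalPreadditive.mk _ _ _ _ ?_ ?_ ?_ ?_ <;> intros <;> apply G.map_injective <;>
    rw [← cancel_epi (μ G _ _)] <;>
    simp [← μ_natural_left, ← μ_natural_right, Preadditive.comp_add, Preadditive.add_comp]

lemma UniversalTensors.monoidalLinear (k : Type*) [CommRing k] [Linear k V] [MonoidalLinear k V]
    [Linear k C] [G.Linear k] [MonoidalPreadditive C] (hG : UniversalTensors G) :
    MonoidalLinear k C := by
  have := hG.epi
  refine @MonoidalLinear.mk _ _ _ _ _ _ _ _ ?_ ?_ <;> intros <;> apply G.map_injective <;>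
    rw [← cancel_epi (μ G _ _)] <;> simp [← μ_natural_left, ← μ_natural_right]

end Bilinear

end Transfer

section LongForget
variable {V : Type u} [Category.{v} V] [MonoidalCategory V] [SymmetricCategory V]
  [MonoidalClosed V] [UnitGenerator V] [HasCoequalizers V] (B : RightBialgebroid V)

instance : B.longForget.IsLeftAdjoint :=
  inferInstanceAs (RightModule.forget B.A).IsLeftAdjoint

instance : B.longForget.IsRightAdjoint :=
  inferInstanceAs (RightModule.forget B.A).IsRightAdjoint

instance : B.longForget.ReflectsIsomorphisms :=
  inferInstanceAs (RightModule.forget B.A).ReflectsIsomorphisms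

instance : B.longForget.Faithful :=
  inferInstanceAs (RightModule.forget B.A).Faithful

instance : HasCoequalizers B.Mod :=
  inferInstanceAs (HasCoequalizers (RightModule B.A))

variable {B} {C : Type*} [Category.{v} C] {G : C ⥤ V}

/-- The crude monadicity theorem applies: being a left adjoint, `G` preserves coequalizers. -/
lemma EquivalenceOver.nonempty_monadicRightAdjoint (E : EquivalenceOver G B.longForget) :
    Nonempty (MonadicRightAdjoint G) := by
  have := E.isLeftAdjoint
  have := E.isRightAdjoint
  have := E.reflectsIsomorphisms
  have : HasCoequalizers C := Adjunction.hasColimitsOfShape_of_equivalence E.functor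
  have : Monad.PreservesColimitOfIsReflexivePair G := ⟨fun _ _ _ => inferInstance⟩
  exact ⟨Monad.monadicOfHasPreservesReflexiveCoequalizersOfReflectsIsomorphisms
    (Adjunction.ofIsRightAdjoint G)⟩

end LongForget

/-! ### Sets and modules -/

section Sets
variable {C : Type*} [Category* C] {G : C ⥤ Type u} {F : Type u ⥤ C}

/-- For sets, the action of `G P` on `G c` is `x · a = G (hat x) a`. -/
def representingActionType (adj : F ⊣ G) : RepresentingAction adj where
  act c := TypeCat.ofHom fun p => G.map (hat adj (TypeCat.ofHom fun _ => p.1)) p.2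
  pair_act x a := by
    ext t
    have hx : (TypeCat.ofHom fun _ => x t) = x := by
      ext s
      rfl
    change G.map (hat adj (TypeCat.ofHom fun _ => x t)) (a t) = G.map (hat adj x) (a t)
    rw [hx]

end Sets

section Modules
variable {k : Type u} [CommRing k] {C : Type*} [Category* C] [Preadditive C] [Linear k C]
  {G : C ⥤ ModuleCat.{u} k} {F : ModuleCat.{u} k ⥤ C}

lemma hat_add [G.Additive] (adj : F ⊣ G) {c : C} (x y : 𝟙_ (ModuleCat k) ⟶ G.obj c) :
    hat adj (x + y) = hat adj x + hat adj y := by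
  apply hom_ext_universalElement adj
  rw [universalElement_hat, G.map_add, Preadditive.comp_add, universalElement_hat,
    universalElement_hat]

lemma hat_smul [G.Additive] [G.Linear k] (adj : F ⊣ G) {c : C} (r : k)
    (x : 𝟙_ (ModuleCat k) ⟶ G.obj c) :
    hat adj (r • x) = r • hat adj x := by
  apply hom_ext_universalElement adj
  rw [universalElement_hat, G.map_smul, Linear.comp_smul, universalElement_hat]

/-- The element of the underlying module as an arrow from the monoidal unit. -/
def elementHom {M : ModuleCat.{u} k} (x : M) : 𝟙_ (ModuleCat.{u} k) ⟶ M :=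
  ModuleCat.ofHom (LinearMap.toSpanSingleton k M x)

lemma elementHom_apply_one {M : ModuleCat.{u} k} (x : 𝟙_ (ModuleCat.{u} k) ⟶ M) :
    elementHom (x (1 : k)) = x := by
  ext
  change (1 : k) • x (1 : k) = x (1 : k)
  rw [one_smul]

variable [G.Additive] [G.Linear k]

/-- For modules, `x · a = G (hat x) a` is bilinear because `G` is linear on morphisms. -/
noncomputable def representingActionModule (adj : F ⊣ G) : RepresentingAction adj where
  act c := ModuleCat.ofHom <| TensorProduct.lift <| LinearMap.mk₂ k
    (fun (x : G.obj c) (a : G.obj (F.obj (𝟙_ _))) => G.map (hat adj (elementHom x)) a)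
    (fun x y a => by
      have : elementHom (x + y) = elementHom x + elementHom y := by
        ext
        simp [elementHom]
      rw [this, hat_add, G.map_add]
      rfl)
    (fun r x a => by
      have : elementHom (r • x) = r • elementHom x := by
        ext
        simp [elementHom]
      rw [this, hat_smul, G.map_smul]
      rfl)
    (fun x a b => map_add _ _ _)
    (fun r x a => map_smul _ _ _)
  pair_act {c} x a := by
    ext
    change G.map (hat adj (elementHom (x (1 : k)))) (a (1 : k)) = G.map (hat adj x) (a (1 : k))
    rw [elementHom_apply_one]

end Modules

end LongForgetful

theorem mainTheorem4 :
    (∀ {C : Type w} [Category.{u} C] (G : C ⥤ Type u),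
      ((∃ B : RightBialgebroid (Type u), Nonempty (EquivalenceOver G B.longForget)) ↔
        Nonempty (MonadicRightAdjoint G) ∧ G.IsLeftAdjoint ∧
          ∃ (_ : MonoidalCategory C) (_ : G.LaxMonoidal), EssentiallyStrong G) ∧
      (Nonempty (MonadicRightAdjoint G) → G.IsLeftAdjoint →
        ∀ [MonoidalCategory C] [G.LaxMonoidal], EssentiallyStrong G →
          ∃ (B : RightBialgebroid (Type u)) (E : EquivalenceOver G B.longForget),
            Nonempty E.MonoidalStructure)) ∧
    (∀ (k : Type u) [CommRing k] {C : Type w} [Category.{u} C] [Preadditive C] [Linear k C]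
      (G : C ⥤ ModuleCat.{u} k) [G.Additive] [G.Linear k],
      ((∃ (B : RightBialgebroid (ModuleCat.{u} k)) (E : EquivalenceOver G B.longForget),
          E.IsLinear k) ↔
        Nonempty (MonadicRightAdjoint G) ∧ G.IsLeftAdjoint ∧
          ∃ (_ : MonoidalCategory C) (_ : MonoidalPreadditive C) (_ : MonoidalLinear k C)
            (_ : G.LaxMonoidal), EssentiallyStrong G) ∧
      (Nonempty (MonadicRightAdjoint G) → G.IsLeftAdjoint →
        ∀ [MonoidalCategory C] [MonoidalPreadditive C] [MonoidalLinear k C] [G.LaxMonoidal],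
          EssentiallyStrong G →
          ∃ (B : RightBialgebroid (ModuleCat.{u} k)) (E : EquivalenceOver G B.longForget),
            E.IsLinear k ∧ Nonempty E.MonoidalStructure)) := by
  refine ⟨fun {C} _ G => ?_, fun k _ {C} _ _ _ G _ _ => ?_⟩
  · have h : Nonempty (MonadicRightAdjoint G) → G.IsLeftAdjoint →
        ∀ [MonoidalCategory C] [G.LaxMonoidal], EssentiallyStrong G →
          ∃ (B : RightBialgebroid (Type u)) (E : EquivalenceOver G B.longForget),
            Nonempty E.MonoidalStructure := by
      intro ⟨hM⟩ hL _ _ hG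
      have : Fact (EssentiallyStrong G) := ⟨hG⟩
      let S := representingActionType (monadicAdjunction G)
      exact ⟨S.bialgebroid, S.equivalenceOver, ⟨S.monoidalStructure⟩⟩
    refine ⟨⟨fun ⟨B, ⟨E⟩⟩ => ?_, fun ⟨hM, hL, _, _, hG⟩ => ?_⟩, h⟩
    · obtain ⟨_, _, hG⟩ := E.exists_universalTensors B.universalTensors_longForget
      exact ⟨E.nonempty_monadicRightAdjoint, E.isLeftAdjoint, _, _, hG.essentiallyStrong⟩
    · obtain ⟨B, E, -⟩ := h hM hL hG
      exact ⟨B, ⟨E⟩⟩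
  · have h : Nonempty (MonadicRightAdjoint G) → G.IsLeftAdjoint →
        ∀ [MonoidalCategory C] [MonoidalPreadditive C] [MonoidalLinear k C] [G.LaxMonoidal],
          EssentiallyStrong G →
          ∃ (B : RightBialgebroid (ModuleCat.{u} k)) (E : EquivalenceOver G B.longForget),
            E.IsLinear k ∧ Nonempty E.MonoidalStructure := by
      intro ⟨hM⟩ hL _ _ _ _ hG
      have : Fact (EssentiallyStrong G) := ⟨hG⟩
      let S := representingActionModule (monadicAdjunction G)
      exact ⟨S.bialgebroid, S.equivalenceOver, S.equivalenceOver.isLinear k, ⟨S.monoidalStructure⟩⟩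
    refine ⟨⟨fun ⟨B, E, _⟩ => ?_, fun ⟨hM, hL, _, _, _, _, hG⟩ => ?_⟩, h⟩
    · obtain ⟨_, _, hG⟩ := E.exists_universalTensors B.universalTensors_longForget
      have := E.faithful
      have := hG.monoidalPreadditive
      exact ⟨E.nonempty_monadicRightAdjoint, E.isLeftAdjoint, _, this, hG.monoidalLinear k, _,
        hG.essentiallyStrong⟩
    · obtain ⟨B, E, hE, -⟩ := h hM hL hG
      exact ⟨B, E, hE⟩
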